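/- **Definitions.** A graphon $H=(\Omega,\mathcal A,\pi,W)$ consists of a probability space $(\Omega,\mathcal A,\pi)$ and a bounded symmetric function $W:\Omega\times\Omega\to\mathbb R$ that is measurable with respect to the completion of $(\Omega\times\Omega,\mathcal A\times\mathcal A,\pi\times\pi)$. For a simple graph $F$ with $V(F)=\{1,\dots,k\}$ put $$t(F,H)=\int_{\Omega^k}\prod_{ij\in E(F)}W(x_i,x_j)\,\prod_{i=1}^k d\pi(x_i).$$ A measure preserving map $\phi:\Omega\to\Omega'$ between probability spaces is an isomorphism mod $0$ if there are measurable null sets $N\subset\Omega$, $N'\subset\Omega'$ such that $\phi$ restricts to a bijection $\Omega\setminus N\to\Omega'\setminus N'$ that is measure preserving in both directions. A Lebesgue space is a complete probability space that is isomorphic mod $0$ to the disjoint union of a closed interval (with the Lebesgue sets and Lebesgue measure; it may be degenerate) and a countable (possibly empty) set of atoms; a graphon on a Lebesgue space is called Lebesguian. Points $x_1,x_2\in\Omega$ are twins if $W(x_1,y)=W(x_2,y)$ for almost all $y\in\Omega$, and $H$ is almost twin-free if there is a null set $N$ such that no two distinct points of $\Omega\setminus N$ are twins. Graphons $H$ and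 $H'=(\Omega',\mathcal A',\pi',W')$ are isomorphic mod $0$, written $H\cong H'$, if there is an isomorphism mod $0$ $\phi:\Omega\to\Omega'$ with $W'(\phi(x),\phi(y))=W(x,y)$ for almost all $(x,y)\in\Omega\times\Omega$. A weak isomorphism from $H$ to a graphon $G=(\Gamma,\mathcal B,\rho,U)$ is a map $\phi:\Omega\to\Gamma$ that is measure preserving from the completion of $(\Omega,\mathcal A,\pi)$ into $(\Gamma,\mathcal B,\rho)$ and satisfies $W(x,y)=U(\phi(x),\phi(y))$ for almost all $(x,y)$. Two graphons are weakly isomorphic if both have weak isomorphisms into a common third graphon. A sequence $(G_n)$ of finite simple graphs with non-empty node sets converges to a graphon $H$ if $t(F,G_n)\to t(F,H)$ for every simple graph $F$, where $t(F,G_n)$ is the probability that a uniformly random map $V(F)\to V(G_n)$ preserves adjacency. **Theorem.** (i) If $H$ and $H'$ are almost twin-free Lebesguian graphons, then $t(F,H)=t(F,H')$ for every simple graph $F$ if and only if $H\cong H'$. (ii) If $H$ and $H'$ are arbitrary graphons, then $t(F,H)=t(F,H')$ for every simple graph $F$ if and only if $H$ and $H'$ are weakly isomorphic. In particular, the limit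 of a convergent graph sequence is unique up to measure preserving transformations: let $W,W':[0,1]^2\to[0,1]$ be symmetric Lebesgue measurable functions, and let $(G_n)$ be a sequence of finite simple graphs with non-empty node sets that converges to $W$ (as a graphon on $[0,1]$ with Lebesgue measure). Then $(G_n)$ converges to $W'$ as well if and only if there are a symmetric Lebesgue measurable function $U:[0,1]^2\to[0,1]$ and measure preserving maps $\varphi,\psi:[0,1]\to[0,1]$ such that $W(x,y)=U(\varphi(x),\varphi(y))$ and $W'(x,y)=U(\psi(x),\psi(y))$ for almost all $(x,y)\in[0,1]^2$. -/

import Mathlib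

open MeasureTheory
open scoped ENNReal

/-- A graphon on the probability space `(Ω, π)`: a bounded symmetric real function of two variables
that is measurable with respect to the completion of the product space. -/
structure Graphon (Ω : Type*) [MeasurableSpace Ω] (π : Measure Ω) [IsProbabilityMeasure π] where
  /-- The underlying two-variable function. -/
  W : Ω → Ω → ℝ
  symm : ∀ x y, W x y = W y x
  bounded : ∃ C : ℝ, ∀ x y, |W x y| ≤ C
  nullMeasurable : NullMeasurable (fun z : Ω × Ω => W z.1 z.2) (π.prod π)

/-- `φ` is an isomorphism mod 0: it is measure preserving, and off measurable null sets it restricts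
to a bijection that is measurable and measure preserving in both directions. -/
def IsIsoModZero {α β : Type*} [MeasurableSpace α] [MeasurableSpace β] (φ : α → β)
    (μ : Measure α) (ν : Measure β) : Prop :=
  MeasurePreserving φ μ ν ∧
    ∃ (N : Set α) (N' : Set β), MeasurableSet N ∧ μ N = 0 ∧ MeasurableSet N' ∧ ν N' = 0 ∧
      ∃ e : ↥(Nᶜ) ≃ᵐ ↥(N'ᶜ), (∀ x, (e x : β) = φ x) ∧
        MeasurePreserving e (μ.comap Subtype.val) (ν.comap Subtype.val)

/-- Lebesgue measure on `[a, b]` plus an atom of mass `p i` for each `i ∈ A`, on the Borel sets of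
the disjoint union of `[a, b]` and `A`. -/
noncomputable def intervalWithAtoms (a b : ℝ) (A : Set ℕ) (p : A → ℝ≥0∞) :
    Measure (Set.Icc a b ⊕ A) :=
  ((volume : Measure ℝ).comap (Subtype.val : Set.Icc a b → ℝ)).map Sum.inl +
    Measure.sum fun i : A => p i • Measure.dirac (Sum.inr i)

/-- A Lebesgue space: a complete space that is isomorphic mod 0 to the disjoint union of
a closed interval (with the Lebesgue sets and Lebesgue measure) and a countable set of atoms.
The Lebesgue sets appear through the completion of the Borel model. -/
def IsLebesgueSpace {Ω : Type*} [MeasurableSpace Ω] (π : Measure Ω) : Prop :=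
  π.IsComplete ∧
    ∃ (a b : ℝ) (A : Set ℕ) (p : A → ℝ≥0∞), a ≤ b ∧ (∀ i, p i ≠ 0) ∧
      ∃ φ : Ω → NullMeasurableSpace (Set.Icc a b ⊕ A) (intervalWithAtoms a b A p),
        IsIsoModZero φ π (intervalWithAtoms a b A p).completion

/-- The homomorphism density `t(F, G)` of a graph `F` in a graph `G` on `m` nodes: the probability
that a uniformly random map `V(F) → V(G)` preserves adjacency. -/
noncomputable def graphDensity {k m : ℕ} (F : SimpleGraph (Fin k)) (G : SimpleGraph (Fin m)) : ℝ :=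
  (Nat.card (F →g G) : ℝ) / (m : ℝ) ^ k

namespace Graphon

variable {Ω Ω' : Type*} [MeasurableSpace Ω] [MeasurableSpace Ω']
  {π : Measure Ω} [IsProbabilityMeasure π] {π' : Measure Ω'} [IsProbabilityMeasure π']

open scoped Classical in
/-- The homomorphism density `t(F, H) = ∫ ∏_{ij ∈ E(F)} W(x_i, x_j) dπ(x_1) ⋯ dπ(x_k)`. -/
noncomputable def density (H : Graphon Ω π) {k : ℕ} (F : SimpleGraph (Fin k)) : ℝ :=
  ∫ x : Fin k → Ω,
    ∏ e ∈ F.edgeFinset, Sym2.lift ⟨fun i j => H.W (x i) (x j), fun i j => H.symm (x i) (x j)⟩ e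
    ∂(Measure.pi fun _ => π)

/-- Two points are twins if their sections agree almost everywhere. -/
def Twins (H : Graphon Ω π) (x₁ x₂ : Ω) : Prop :=
  ∀ᵐ y ∂π, H.W x₁ y = H.W x₂ y

/-- Off some null set there are no two distinct twins. -/
def AlmostTwinFree (H : Graphon Ω π) : Prop :=
  ∃ N : Set Ω, π N = 0 ∧ ∀ x₁ ∉ N, ∀ x₂ ∉ N, x₁ ≠ x₂ → ¬ H.Twins x₁ x₂

/-- Isomorphism mod 0 of graphons. -/
def IsomorphicModZero (H : Graphon Ω π) (H' : Graphon Ω' π') : Prop :=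
  ∃ φ : Ω → Ω', IsIsoModZero φ π π' ∧
    ∀ᵐ z ∂π.prod π, H'.W (φ z.1) (φ z.2) = H.W z.1 z.2

/-- `φ` is a weak isomorphism from `H` to `G`: it is measure preserving from the completion of the
first space into the second, and `H` is almost everywhere the pull-back of `G`. -/
def IsWeakIso (H : Graphon Ω π) (G : Graphon Ω' π') (φ : Ω → Ω') : Prop :=
  MeasurePreserving (α := NullMeasurableSpace Ω π) φ π.completion π' ∧
    ∀ᵐ z ∂π.prod π, H.W z.1 z.2 = G.W (φ z.1) (φ z.2)

/-- All values of the graphon lie in `[0, 1]`. -/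
def UnitValued (H : Graphon Ω π) : Prop :=
  ∀ x y, H.W x y ∈ Set.Icc (0 : ℝ) 1

/-- The sequence of graphs `G n` (on `m n` nodes) converges to `H`. -/
def IsLimitOf (H : Graphon Ω π) {m : ℕ → ℕ} (G : ∀ n, SimpleGraph (Fin (m n))) : Prop :=
  ∀ (k : ℕ) (F : SimpleGraph (Fin k)),
    Filter.Tendsto (fun n => graphDensity F (G n)) Filter.atTop (nhds (H.density F))

end Graphon

universe u v w

/-- Two graphons are weakly isomorphic if both have weak isomorphisms into a third one. -/
def Graphon.WeaklyIsomorphic {Ω : Type u} {Ω' : Type v} [MeasurableSpace Ω] [MeasurableSpace Ω']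
    {π : Measure Ω} [IsProbabilityMeasure π] {π' : Measure Ω'} [IsProbabilityMeasure π']
    (H : Graphon Ω π) (H' : Graphon Ω' π') : Prop :=
  ∃ (Γ : Type w) (_ : MeasurableSpace Γ) (ρ : Measure Γ) (_ : IsProbabilityMeasure ρ)
    (G : Graphon Γ ρ) (φ : Ω → Γ) (ψ : Ω' → Γ), H.IsWeakIso G φ ∧ H'.IsWeakIso G ψ

/-! Weak isomorphisms preserve densities by a change of variables. For the converse, every graphon
is first pulled back from a measurable one on a standard Borel space. Fix a sequence of points `a
j`, the anchors, and map `x` to the sequence of values `conv x (a j)`, where `conv` is the square of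
`W` as an integral operator. If almost every section of `W` is an `L²`-limit of sections at anchors,
this sequence determines the distances from the section at `x` to those at the anchors, hence the
section itself. Consequently `W` is a function `U` of the images of its two arguments. Independent
random anchors have this density property almost surely (`ae_exists_factor_anchorMap`).

Given the anchors, the law of the anchor map and the function `U` are determined by countably many
anchored moments (`exists_common_factor`). For random anchors, the joint moments of these numbers
are integrals of products of `W` and `conv`. A factor `conv` is a path of length two through a new
vertex, so even repeated factors produce a simple graph, and the integral is a homomorphism density
(`integral_moments_eq`). Anchoring with `W` itself would produce multiple edges. Equal densities
therefore give the random moment families the same distribution, and some pair of good anchor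
sequences, one on each side, has identical moments (`exists_eq_of_map_eq`). Both graphons are then
pull-backs of one graphon on the space of sequences, which is (ii).

For (i), twin-freeness makes the two maps into the common graphon injective off null sets. On
Lebesgue spaces such maps have measurable inverses by Lusin–Souslin, and composing one map with the
inverse of the other gives the isomorphism. For graph limits the common space must become `[0,1]`:
its atoms are spread over intervals, the resulting atomless space is isomorphic to the unit
interval, and the maps lift to it (`exists_lift_spreadAtoms`). -/

/-! ### Measure preserving maps on completed spaces -/

section NullMeasurePreserving

variable {α β γ : Type*} [MeasurableSpace α] [MeasurableSpace β] [MeasurableSpace γ]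
  {μ : Measure α} {ν : Measure β} {ξ : Measure γ}

/-- `φ` is measure preserving from the completion of `(α, μ)` to `(β, ν)`. -/
structure NullMeasurePreserving (φ : α → β) (μ : Measure α) (ν : Measure β) : Prop where
  nullMeasurable : NullMeasurable φ μ
  measure_preimage : ∀ s, MeasurableSet s → μ (φ ⁻¹' s) = ν s

theorem nullMeasurePreserving_iff {φ : α → β} :
    NullMeasurePreserving φ μ ν ↔
      MeasurePreserving (α := NullMeasurableSpace α μ) φ μ.completion ν := by
  constructor
  · intro h
    refine ⟨fun s hs => h.nullMeasurable hs, ?_⟩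
    ext s hs
    rw [Measure.map_apply (fun s hs => h.nullMeasurable hs) hs]
    exact h.measure_preimage s hs
  · intro h
    exact ⟨fun s hs => h.measurable hs, fun s hs => by
      rw [← h.map_eq]; exact (Measure.map_apply (μ := μ.completion) h.measurable hs).symm⟩

namespace NullMeasurePreserving

theorem ae {φ : α → β} (h : NullMeasurePreserving φ μ ν) {p : β → Prop} (hp : ∀ᵐ y ∂ν, p y) :
    ∀ᵐ x ∂μ, p (φ x) := by
  refine measure_mono_null (t := φ ⁻¹' toMeasurable ν {y | ¬ p y})
    (Set.preimage_mono (f := φ) (subset_toMeasurable ν {y | ¬ p y})) ?_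
  rw [h.measure_preimage _ (measurableSet_toMeasurable _ _), measure_toMeasurable]
  exact hp

theorem measure_preimage₀ {φ : α → β} (h : NullMeasurePreserving φ μ ν) {s : Set β}
    (hs : NullMeasurableSet s ν) : NullMeasurableSet (φ ⁻¹' s) μ ∧ μ (φ ⁻¹' s) = ν s := by
  obtain ⟨t, ht, hst⟩ := hs
  have h1 : φ ⁻¹' s =ᵐ[μ] φ ⁻¹' t := h.ae hst
  exact ⟨(h.nullMeasurable ht).congr h1.symm, by
    rw [measure_congr h1, h.measure_preimage t ht, ← measure_congr hst]⟩

theorem comp {ψ : β → γ} {φ : α → β} (hψ : NullMeasurePreserving ψ ν ξ)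
    (hφ : NullMeasurePreserving φ μ ν) : NullMeasurePreserving (ψ ∘ φ) μ ξ :=
  ⟨fun _ hs => (hφ.measure_preimage₀ (hψ.nullMeasurable hs)).1, fun s hs => by
    rw [Set.preimage_comp, (hφ.measure_preimage₀ (hψ.nullMeasurable hs)).2,
      hψ.measure_preimage s hs]⟩

theorem congr {φ ψ : α → β} (h : NullMeasurePreserving φ μ ν) (he : φ =ᵐ[μ] ψ) :
    NullMeasurePreserving ψ μ ν :=
  ⟨h.nullMeasurable.congr he, fun s hs => by
    rw [← h.measure_preimage s hs]
    refine measure_congr ?_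
    filter_upwards [he] with x hx
    exact congrArg (· ∈ s) hx.symm⟩

theorem isProbabilityMeasure [IsProbabilityMeasure μ] {φ : α → β}
    (h : NullMeasurePreserving φ μ ν) : IsProbabilityMeasure ν :=
  ⟨by rw [← h.measure_preimage _ MeasurableSet.univ, Set.preimage_univ, measure_univ]⟩

/-- A null-measurable map into a countably generated space agrees almost everywhere with
a measure preserving map. -/
theorem exists_measurePreserving [MeasurableSpace.CountablyGenerated β] {φ : α → β}
    (h : NullMeasurePreserving φ μ ν) : ∃ ψ : α → β, MeasurePreserving ψ μ ν ∧ φ =ᵐ[μ] ψ := by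
  have ha := h.nullMeasurable.aemeasurable
  refine ⟨ha.mk φ, ⟨ha.measurable_mk, ?_⟩, ha.ae_eq_mk⟩
  ext s hs
  rw [Measure.map_apply ha.measurable_mk hs]
  exact (h.congr ha.ae_eq_mk).measure_preimage s hs

theorem integral_comp {φ : α → β} (h : NullMeasurePreserving φ μ ν) {f : β → ℝ}
    (hf : AEMeasurable f ν) : ∫ x, f (φ x) ∂μ = ∫ y, f y ∂ν := by
  -- `φ` itself may have no measurable representative, but its composite with a real function has
  -- one, since `ℝ` is countably generated.
  have h1 : NullMeasurePreserving (hf.mk f) ν (ν.map (hf.mk f)) :=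
    ⟨hf.measurable_mk.nullMeasurable, fun s hs => (Measure.map_apply hf.measurable_mk hs).symm⟩
  obtain ⟨k, hk, hke⟩ := (h1.comp h).exists_measurePreserving
  calc ∫ x, f (φ x) ∂μ = ∫ x, k x ∂μ := by
        refine integral_congr_ae ?_
        filter_upwards [h.ae hf.ae_eq_mk, hke] with x hx hx'
        rw [hx]; exact hx'
    _ = ∫ t, t ∂(μ.map k) := (integral_map hk.measurable.aemeasurable
          measurable_id.aestronglyMeasurable).symm
    _ = ∫ t, t ∂(ν.map (hf.mk f)) := by rw [hk.map_eq]
    _ = ∫ y, hf.mk f y ∂ν := integral_map hf.measurable_mk.aemeasurable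
          measurable_id.aestronglyMeasurable
    _ = ∫ y, f y ∂ν := integral_congr_ae hf.ae_eq_mk.symm

/-- Rectangles determine the law, and `Measure.prod_prod` holds for arbitrary sides, so the
preimages of measurable sets need only be null measurable. -/
theorem prodMap [IsProbabilityMeasure μ] [IsProbabilityMeasure ν] {φ : α → β}
    (h : NullMeasurePreserving φ μ ν) :
    NullMeasurePreserving (Prod.map φ φ) (μ.prod μ) (ν.prod ν) := by
  have hm : Measurable (α := NullMeasurableSpace (α × α) (μ.prod μ)) (Prod.map φ φ) := by
    refine Measurable.prodMk (fun s hs => ?_) (fun s hs => ?_)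
    · exact (h.nullMeasurable hs).preimage Measure.quasiMeasurePreserving_fst
    · exact (h.nullMeasurable hs).preimage Measure.quasiMeasurePreserving_snd
  refine nullMeasurePreserving_iff.2 ⟨hm, ?_⟩
  symm
  refine Measure.prod_eq fun s t hs ht => ?_
  refine (Measure.map_apply hm (hs.prod ht)).trans ?_
  change (μ.prod μ) ((φ ⁻¹' s) ×ˢ (φ ⁻¹' t)) = _
  rw [Measure.prod_prod, h.measure_preimage s hs, h.measure_preimage t ht]

theorem piMap [IsProbabilityMeasure μ] [IsProbabilityMeasure ν] {φ : α → β}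
    (h : NullMeasurePreserving φ μ ν) (ι : Type*) [Fintype ι] :
    NullMeasurePreserving (fun (x : ι → α) i => φ (x i)) (Measure.pi fun _ => μ)
      (Measure.pi fun _ => ν) := by
  have hm : Measurable (α := NullMeasurableSpace (ι → α) (Measure.pi fun _ => μ))
      (fun x i => φ (x i)) := by
    refine measurable_pi_lambda _ fun i s hs => ?_
    exact (h.nullMeasurable hs).preimage (Measure.quasiMeasurePreserving_eval (fun _ => μ) i)
  refine nullMeasurePreserving_iff.2 ⟨hm, ?_⟩
  symm
  refine Measure.pi_eq fun s hs => ?_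
  refine (Measure.map_apply hm (MeasurableSet.univ_pi hs)).trans ?_
  change (Measure.pi fun _ => μ) (Set.univ.pi fun i => φ ⁻¹' s i) = _
  rw [Measure.pi_pi]
  exact Finset.prod_congr rfl fun i _ => h.measure_preimage _ (hs i)

end NullMeasurePreserving

theorem MeasureTheory.MeasurePreserving.nullMeasurePreserving {φ : α → β}
    (h : MeasurePreserving φ μ ν) : NullMeasurePreserving φ μ ν :=
  ⟨h.measurable.nullMeasurable, fun _ hs => h.measure_preimage hs.nullMeasurableSet⟩

/-- Two distinct coordinates of a product of copies of `μ` are jointly distributed as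
`μ.prod μ`. -/
theorem measurePreserving_eval_pair [IsProbabilityMeasure μ] {ι : Type*} [Fintype ι] {i j : ι}
    (hij : i ≠ j) :
    MeasurePreserving (fun x : ι → α => (x i, x j)) (Measure.pi fun _ => μ) (μ.prod μ) := by
  refine ⟨by fun_prop, ?_⟩
  have h := (ProbabilityTheory.iIndepFun_pi (μ := fun _ : ι => μ) (X := fun _ x => x)
    (fun _ => aemeasurable_id)).indepFun hij
  rw [ProbabilityTheory.indepFun_iff_map_prod_eq_prod_map_map
    (measurable_pi_apply i).aemeasurable (measurable_pi_apply j).aemeasurable] at h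
  rw [h]
  congr 1
  · exact (measurePreserving_eval (fun _ : ι => μ) i).map_eq
  · exact (measurePreserving_eval (fun _ : ι => μ) j).map_eq

end NullMeasurePreserving

/-! ### Weak isomorphisms preserve densities -/

namespace Graphon

variable {Ω Ω' : Type*} [MeasurableSpace Ω] [MeasurableSpace Ω']
  {π : Measure Ω} [IsProbabilityMeasure π] {π' : Measure Ω'} [IsProbabilityMeasure π']

theorem isWeakIso_iff {H : Graphon Ω π} {G : Graphon Ω' π'} {φ : Ω → Ω'} :
    H.IsWeakIso G φ ↔ NullMeasurePreserving φ π π' ∧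
      ∀ᵐ z ∂π.prod π, H.W z.1 z.2 = G.W (φ z.1) (φ z.2) := by
  rw [nullMeasurePreserving_iff]; rfl

theorem IsWeakIso.comp {Ω'' : Type*} [MeasurableSpace Ω''] {π'' : Measure Ω''}
    [IsProbabilityMeasure π''] {H : Graphon Ω π} {H' : Graphon Ω' π'} {H'' : Graphon Ω'' π''}
    {φ : Ω → Ω'} {ψ : Ω' → Ω''} (hψ : H'.IsWeakIso H'' ψ) (hφ : H.IsWeakIso H' φ) :
    H.IsWeakIso H'' (ψ ∘ φ) := by
  rw [isWeakIso_iff] at *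
  refine ⟨hψ.1.comp hφ.1, ?_⟩
  filter_upwards [hφ.2, hφ.1.prodMap.ae hψ.2] with z h1 h2
  rw [h1]; exact h2

theorem IsWeakIso.density_eq {H : Graphon Ω π} {G : Graphon Ω' π'} {φ : Ω → Ω'}
    (h : H.IsWeakIso G φ) {k : ℕ} (F : SimpleGraph (Fin k)) : H.density F = G.density F := by
  classical
  rw [isWeakIso_iff] at h
  unfold density
  rw [← (h.1.piMap (Fin k)).integral_comp]
  · refine integral_congr_ae ?_
    -- The almost everywhere identity says nothing about the diagonal; absence of loops makes this
    -- harmless.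
    have : ∀ᵐ x ∂(Measure.pi fun _ : Fin k => π), ∀ i j, i ≠ j →
        H.W (x i) (x j) = G.W (φ (x i)) (φ (x j)) := by
      rw [ae_all_iff]; intro i
      rw [ae_all_iff]; intro j
      by_cases hij : i = j
      · simp [hij]
      · filter_upwards [(measurePreserving_eval_pair hij).quasiMeasurePreserving.ae h.2] with x hx _
        exact hx
    filter_upwards [this] with x hx
    refine Finset.prod_congr rfl fun e he => ?_
    induction e with
    | _ i j =>
      rw [SimpleGraph.mem_edgeFinset, SimpleGraph.mem_edgeSet] at he
      exact hx i j he.ne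
  · refine Finset.aemeasurable_fun_prod _ fun e he => ?_
    induction e with
    | _ i j =>
      rw [SimpleGraph.mem_edgeFinset, SimpleGraph.mem_edgeSet] at he
      exact G.nullMeasurable.aemeasurable.comp_quasiMeasurePreserving
        (measurePreserving_eval_pair he.ne).quasiMeasurePreserving

end Graphon

/-! ### Reduction to standard Borel spaces -/

section CountablyGenerated

variable {Ω : Type*} [MeasurableSpace Ω]

/-- A measurable subset of a square only depends on countably many measurable sets of the
factor. -/
theorem MeasurableSet.exists_eq_preimage_prodMap {s : Set (Ω × Ω)} (hs : MeasurableSet s) :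
    ∃ ψ : Ω → (ℕ → Prop), Measurable ψ ∧ ∃ t, MeasurableSet t ∧ Prod.map ψ ψ ⁻¹' t = s := by
  classical
  -- The sets with this property contain the rectangles and form a σ-algebra; for a countable union
  -- the sequences of sets are interleaved through `Nat.unpair`.
  rw [← generateFrom_prod] at hs
  induction s, hs using MeasurableSpace.generateFrom_induction with
  | hC s hs _ =>
    obtain ⟨a, ha, b, hb, rfl⟩ := hs
    refine ⟨fun x n => if n = 0 then x ∈ a else x ∈ b, measurable_pi_lambda _ fun n => ?_,
      {p | p.1 0} ∩ {p | p.2 1}, ?_, ?_⟩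
    · by_cases hn : n = 0
      · simpa [hn] using ha
      · simpa [hn] using hb
    · exact MeasurableSet.inter
        (measurableSet_setOfPred.2 ((measurable_pi_apply 0).comp measurable_fst))
        (measurableSet_setOfPred.2 ((measurable_pi_apply 1).comp measurable_snd))
    · ext ⟨x, y⟩; simp
  | empty => exact ⟨fun _ _ => True, measurable_const, ∅, MeasurableSet.empty, rfl⟩
  | compl s _ ih =>
    obtain ⟨ψ, hψ, t, ht, rfl⟩ := ih
    exact ⟨ψ, hψ, tᶜ, ht.compl, rfl⟩
  | iUnion s _ ih =>
    choose ψ hψ t ht h using ih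
    refine ⟨fun x n => ψ n.unpair.1 x n.unpair.2, measurable_pi_lambda _ fun n =>
      (measurable_pi_apply _).comp (hψ _),
      ⋃ k, (Prod.map (fun u n => u (Nat.pair k n)) (fun u n => u (Nat.pair k n))) ⁻¹' t k,
      MeasurableSet.iUnion fun k => ?_, ?_⟩
    · have : Measurable fun (u : ℕ → Prop) n => u (Nat.pair k n) :=
        measurable_pi_lambda _ fun n => measurable_pi_apply _
      exact (this.prodMap this) (ht k)
    · rw [Set.preimage_iUnion]
      refine Set.iUnion_congr fun k => ?_
      rw [← h k]
      ext ⟨x, y⟩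
      simp [Nat.unpair_pair]

/-- A measurable function on a square factors through a map of the factor into a standard Borel
space. -/
theorem Measurable.exists_eq_comp_prodMap {f : Ω × Ω → ℝ} (hf : Measurable f) :
    ∃ (ψ : Ω → (ℚ → ℕ → Prop)) (g : (ℚ → ℕ → Prop) × (ℚ → ℕ → Prop) → ℝ),
      Measurable ψ ∧ Measurable g ∧ f = g ∘ Prod.map ψ ψ := by
  have h1 : ∀ q : ℚ, MeasurableSet (f ⁻¹' Set.Iio (q : ℝ)) := fun q => hf measurableSet_Iio
  choose ψ hψ t ht h using fun q => (h1 q).exists_eq_preimage_prodMap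
  have hψ' : Measurable fun x q => ψ q x := measurable_pi_lambda _ hψ
  -- Rational half-lines generate the Borel sets, so `f` is measurable for the pulled-back
  -- σ-algebra, and the Doob–Dynkin lemma supplies `g`.
  have hf' : Measurable[MeasurableSpace.comap
      (Prod.map (fun x q => ψ q x) (fun x q => ψ q x)) inferInstance] f := by
    rw [BorelSpace.measurable_eq (α := ℝ), Real.borel_eq_generateFrom_Iio_rat]
    refine @measurable_generateFrom _ _ (_) _ _ fun s hs => ?_
    simp only [Set.mem_iUnion, Set.mem_singleton_iff] at hs
    obtain ⟨q, rfl⟩ := hs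
    refine ⟨Prod.map (fun u => u q) (fun u => u q) ⁻¹' t q, ?_, h q⟩
    exact ((measurable_pi_apply q).prodMap (measurable_pi_apply q)) (ht q)
  obtain ⟨g, hg, hfg⟩ := hf'.exists_eq_measurable_comp
  exact ⟨_, g, hψ', hg, hfg⟩

end CountablyGenerated

namespace Graphon

variable {Ω S : Type*} [MeasurableSpace Ω] [MeasurableSpace S]
  {π : Measure Ω} [IsProbabilityMeasure π] {ρ : Measure S} [IsProbabilityMeasure ρ]

/-- A graphon that agrees almost everywhere with the pull-back of a measurable function has a weak
isomorphism into a graphon with a measurable function, and bounds on its values are kept. -/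
theorem exists_isWeakIso_of_ae_eq (H : Graphon Ω π) {ψ : Ω → S}
    (hψ : NullMeasurePreserving ψ π ρ) {g : S × S → ℝ} (hg : Measurable g)
    (h : ∀ᵐ z ∂π.prod π, H.W z.1 z.2 = g (ψ z.1, ψ z.2)) {a b : ℝ} (hab : a ≤ b)
    (hH : ∀ x y, H.W x y ∈ Set.Icc a b) :
    ∃ G : Graphon S ρ, Measurable (fun z : S × S => G.W z.1 z.2) ∧ H.IsWeakIso G ψ ∧
      (∀ x y, G.W x y ∈ Set.Icc a b) ∧ ∀ᵐ z ∂ρ.prod ρ, G.W z.1 z.2 = g z := by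
  -- Nothing forces `g` to be symmetric or bounded everywhere. Symmetrizing and truncating repairs
  -- this, and changes `g` only on a null set because the pull-back already has both properties.
  have hm : Measurable fun z : S × S => max a (min b ((g z + g z.swap) / 2)) := by fun_prop
  have hW : ∀ x y, max a (min b ((g (x, y) + g (y, x)) / 2)) ∈ Set.Icc a b := fun x y =>
    ⟨le_max_left _ _, max_le hab (min_le_left _ _)⟩
  have hswap : ∀ᵐ z ∂π.prod π, H.W z.2 z.1 = g (ψ z.2, ψ z.1) :=
    (Measure.measurePreserving_swap (μ := π) (ν := π)).quasiMeasurePreserving.ae h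
  have key : ∀ᵐ z ∂π.prod π,
      max a (min b ((g (ψ z.1, ψ z.2) + g (ψ z.2, ψ z.1)) / 2)) = g (ψ z.1, ψ z.2) := by
    filter_upwards [h, hswap] with z h1 h2
    rw [← h1, ← h2, H.symm z.2 z.1, add_self_div_two, min_eq_right (hH _ _).2,
      max_eq_right (hH _ _).1]
  refine ⟨⟨fun x y => max a (min b ((g (x, y) + g (y, x)) / 2)), fun x y => by rw [add_comm],
    ⟨max |a| |b|, fun x y => abs_le_max_abs_abs (hW x y).1 (hW x y).2⟩, hm.nullMeasurable⟩,
    hm, isWeakIso_iff.2 ⟨hψ, ?_⟩, hW, ?_⟩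
  · filter_upwards [h, key] with z h1 h2
    rw [h1]; exact h2.symm
  · have h3 : MeasurableSet {z : S × S | max a (min b ((g z + g z.swap) / 2)) = g z} :=
      measurableSet_eq_fun hm hg
    have h4 := (hψ.prodMap).measure_preimage _ h3.compl
    rw [ae_iff]
    refine Eq.trans h4.symm ?_
    exact key

/-- Every graphon has a weak isomorphism into a graphon with a measurable function on a standard
Borel space. -/
theorem exists_isWeakIso_standardBorel (H : Graphon Ω π) :
    ∃ (ρ : Measure (ℚ → ℕ → Prop)) (_ : IsProbabilityMeasure ρ) (G : Graphon (ℚ → ℕ → Prop) ρ)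
      (ψ : Ω → (ℚ → ℕ → Prop)), Measurable (fun z : _ × _ => G.W z.1 z.2) ∧ H.IsWeakIso G ψ := by
  have ha := H.nullMeasurable.aemeasurable
  obtain ⟨ψ, g, hψ, hg, hfg⟩ := ha.measurable_mk.exists_eq_comp_prodMap
  obtain ⟨C, hC⟩ := H.bounded
  have hp : IsProbabilityMeasure (π.map ψ) := Measure.isProbabilityMeasure_map hψ.aemeasurable
  obtain ⟨x⟩ := nonempty_of_isProbabilityMeasure π
  obtain ⟨G, hG, hw, -⟩ := H.exists_isWeakIso_of_ae_eq (ρ := π.map ψ)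
    (MeasurePreserving.nullMeasurePreserving ⟨hψ, rfl⟩) hg
    (by filter_upwards [ha.ae_eq_mk] with z hz; rw [hz, hfg]; rfl)
    (neg_le_self ((abs_nonneg _).trans (hC x x))) (fun x y => abs_le.1 (hC x y))
  exact ⟨_, hp, G, ψ, hG, hw⟩

end Graphon

/-! ### Bounded measurable functions and integration over one coordinate -/

section BddMeasurable

variable {α β ι : Type*} [MeasurableSpace α] [MeasurableSpace β]

/-- Bounded measurable real functions. -/
structure BddMeasurable (f : α → ℝ) : Prop where
  measurable : Measurable f
  bounded : ∃ C : ℝ, ∀ x, |f x| ≤ C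

namespace BddMeasurable

theorem const (c : ℝ) : BddMeasurable fun _ : α => c := ⟨measurable_const, |c|, fun _ => le_rfl⟩

theorem mul {f g : α → ℝ} (hf : BddMeasurable f) (hg : BddMeasurable g) :
    BddMeasurable fun x => f x * g x := by
  obtain ⟨C, hC⟩ := hf.bounded
  obtain ⟨D, hD⟩ := hg.bounded
  refine ⟨hf.measurable.mul hg.measurable, C * D, fun x => ?_⟩
  rw [abs_mul]
  exact mul_le_mul (hC x) (hD x) (abs_nonneg _) ((abs_nonneg _).trans (hC x))

theorem comp {f : β → ℝ} (hf : BddMeasurable f) {g : α → β} (hg : Measurable g) :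
    BddMeasurable fun x => f (g x) :=
  ⟨hf.measurable.comp hg, hf.bounded.imp fun _ h x => h (g x)⟩

theorem list_prod {f : ι → α → ℝ} (l : List ι) (hf : ∀ i ∈ l, BddMeasurable (f i)) :
    BddMeasurable fun x => (l.map fun i => f i x).prod := by
  induction l with
  | nil => simpa using const 1
  | cons i l ih =>
    simp only [List.map_cons, List.prod_cons]
    exact (hf i (by simp)).mul (ih fun j hj => hf j (by simp [hj]))

theorem finset_prod {f : ι → α → ℝ} (s : Finset ι) (hf : ∀ i ∈ s, BddMeasurable (f i)) :
    BddMeasurable fun x => ∏ i ∈ s, f i x := by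
  simp only [Finset.prod_eq_multiset_prod]
  rcases s with ⟨⟨l⟩, hl⟩
  simpa using list_prod l (by simpa using hf)

theorem integrable {f : α → ℝ} (hf : BddMeasurable f) (μ : Measure α) [IsFiniteMeasure μ] :
    Integrable f μ := by
  obtain ⟨C, hC⟩ := hf.bounded
  exact Integrable.of_bound hf.measurable.aestronglyMeasurable C
    (Filter.Eventually.of_forall hC)

theorem integral_right {f : α × β → ℝ} (hf : BddMeasurable f) (ν : Measure β)
    [IsProbabilityMeasure ν] : BddMeasurable fun x => ∫ y, f (x, y) ∂ν := by
  obtain ⟨C, hC⟩ := hf.bounded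
  refine ⟨(hf.measurable.stronglyMeasurable.integral_prod_right').measurable, C, fun x => ?_⟩
  simpa using norm_integral_le_of_norm_le_const (μ := ν) (f := fun y => f (x, y)) (C := C)
    (by simpa using Filter.Eventually.of_forall fun y => hC (x, y))

end BddMeasurable

end BddMeasurable

theorem integral_pi_fin_succ {Ω : Type*} [MeasurableSpace Ω] (π : Measure Ω)
    [IsProbabilityMeasure π] {n : ℕ} {f : (Fin (n + 1) → Ω) → ℝ} (hf : BddMeasurable f) :
    ∫ x, f x ∂(Measure.pi fun _ => π) =
      ∫ x : Fin n → Ω, ∫ z, f (Fin.cons z x) ∂π ∂(Measure.pi fun _ => π) := by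
  have h := (measurePreserving_piFinSuccAbove (fun _ : Fin (n + 1) => π) 0).symm
  have e : ∀ z : Ω × (Fin n → Ω), (MeasurableEquiv.piFinSuccAbove (fun _ => Ω) 0).symm z =
      (Fin.cons z.1 z.2 : Fin (n + 1) → Ω) := fun z => by
    rw [MeasurableEquiv.piFinSuccAbove_symm_apply]
    exact Fin.insertNth_zero' z.1 z.2
  rw [← h.integral_comp' f, integral_prod_symm]
  · simp only [e]
  · exact (hf.comp (MeasurableEquiv.measurable _)).integrable _

theorem measurable_fin_cons {Ω : Type*} [MeasurableSpace Ω] {n : ℕ} :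
    Measurable fun p : (Fin n → Ω) × Ω => (Fin.cons p.2 p.1 : Fin (n + 1) → Ω) := by
  refine measurable_pi_lambda _ fun i => ?_
  refine Fin.cases ?_ (fun i => ?_) i
  · simpa using measurable_snd
  · simpa using (by fun_prop : Measurable fun p : (Fin n → Ω) × Ω => p.1 i)

/-! ### Anchored moments as combinations of graph densities -/

namespace Graphon

variable {Ω : Type*} [MeasurableSpace Ω] {π : Measure Ω} [IsProbabilityMeasure π]

/-- The convolution square `∫ W(x, z) W(z, y) dπ(z)`. -/
noncomputable def conv (H : Graphon Ω π) (x y : Ω) : ℝ := ∫ z, H.W x z * H.W z y ∂π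

theorem bddMeasurable_W {H : Graphon Ω π} (hH : Measurable fun z : Ω × Ω => H.W z.1 z.2) :
    BddMeasurable fun z : Ω × Ω => H.W z.1 z.2 :=
  ⟨hH, H.bounded.imp fun _ h z => h z.1 z.2⟩

theorem bddMeasurable_conv {H : Graphon Ω π} (hH : Measurable fun z : Ω × Ω => H.W z.1 z.2) :
    BddMeasurable fun z : Ω × Ω => H.conv z.1 z.2 := by
  have h := bddMeasurable_W hH
  exact ((h.comp (g := fun p : (Ω × Ω) × Ω => (p.1.1, p.2)) (by fun_prop)).mul
    (h.comp (g := fun p : (Ω × Ω) × Ω => (p.2, p.1.2)) (by fun_prop))).integral_right π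

/-- The value of `W` on an unordered pair of indices. -/
def edgeValue (H : Graphon Ω π) {V : Type*} (x : V → Ω) (e : Sym2 V) : ℝ :=
  Sym2.lift ⟨fun i j => H.W (x i) (x j), fun i j => H.symm (x i) (x j)⟩ e

@[simp]
theorem edgeValue_mk (H : Graphon Ω π) {V : Type*} (x : V → Ω) (i j : V) :
    H.edgeValue x s(i, j) = H.W (x i) (x j) := rfl

theorem edgeValue_map (H : Graphon Ω π) {V V' : Type*} (f : V → V') (x : V' → Ω) (e : Sym2 V) :
    H.edgeValue x (e.map f) = H.edgeValue (x ∘ f) e := by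
  induction e with | _ i j => rfl

/-- A product of values of `W` over `E` and of values of the convolution square over `l`. -/
noncomputable def monomial (H : Graphon Ω π) {V : Type*} (E : Finset (Sym2 V))
    (l : List (V × V)) (x : V → Ω) : ℝ :=
  (∏ e ∈ E, H.edgeValue x e) * (l.map fun p => H.conv (x p.1) (x p.2)).prod

theorem bddMeasurable_monomial {H : Graphon Ω π}
    (hH : Measurable fun z : Ω × Ω => H.W z.1 z.2) {V : Type*} (E : Finset (Sym2 V))
    (l : List (V × V)) : BddMeasurable (H.monomial E l) := by
  refine BddMeasurable.mul (BddMeasurable.finset_prod E fun e _ => ?_)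
    (BddMeasurable.list_prod (f := fun (p : V × V) (x : V → Ω) => H.conv (x p.1) (x p.2)) l
      fun p _ => ?_)
  · induction e with
    | _ i j =>
      exact (bddMeasurable_W hH).comp (g := fun x : V → Ω => (x i, x j)) (by fun_prop)
  · exact (bddMeasurable_conv hH).comp (g := fun x : V → Ω => (x p.1, x p.2)) (by fun_prop)

theorem monomial_image (H : Graphon Ω π) {V V' : Type*} [DecidableEq V'] {f : V → V'}
    (hf : Function.Injective f) (E : Finset (Sym2 V)) (l : List (V × V)) (x : V' → Ω) :
    H.monomial (E.image (Sym2.map f)) (l.map (Prod.map f f)) x = H.monomial E l (x ∘ f) := by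
  unfold monomial
  rw [Finset.prod_image fun a _ b _ h => Sym2.map.injective hf h]
  simp only [edgeValue_map, List.map_map]
  rfl

/-- A convolution edge can be replaced by a path of length two through a new vertex. -/
theorem integral_monomial_cons {H : Graphon Ω π}
    (hH : Measurable fun z : Ω × Ω => H.W z.1 z.2) {n : ℕ} (E : Finset (Sym2 (Fin n)))
    {i j : Fin n} (hij : i ≠ j) (l : List (Fin n × Fin n)) :
    ∫ x, H.monomial E ((i, j) :: l) x ∂(Measure.pi fun _ => π) =
      ∫ x, H.monomial (insert s(0, i.succ) (insert s(0, j.succ)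
          (E.image (Sym2.map Fin.succ)))) (l.map (Prod.map Fin.succ Fin.succ)) x
        ∂(Measure.pi fun _ => π) := by
  -- The new edges contain the new vertex `0`, so they are not among the shifted ones, and `i ≠ j`
  -- separates them from each other. This keeps the graph simple.
  have hs : ∀ k : Fin n, s(0, k.succ) ∉ E.image (Sym2.map Fin.succ) := by
    intro k hk
    obtain ⟨e, -, he⟩ := Finset.mem_image.1 hk
    induction e with
    | _ a b =>
      have := Sym2.mem_mk_left (0 : Fin (n + 1)) k.succ
      rw [← he, Sym2.map_mk, Sym2.mem_iff] at this
      rcases this with h | h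
      · exact Fin.succ_ne_zero a h.symm
      · exact Fin.succ_ne_zero b h.symm
  have hij' : s((0 : Fin (n + 1)), i.succ) ≠ s(0, j.succ) := by
    simp [hij]
  rw [integral_pi_fin_succ π (bddMeasurable_monomial hH _ _)]
  refine integral_congr_ae (Filter.Eventually.of_forall fun x => ?_)
  have : ∀ z : Ω, H.monomial (insert s(0, i.succ) (insert s(0, j.succ)
      (E.image (Sym2.map Fin.succ)))) (l.map (Prod.map Fin.succ Fin.succ)) (Fin.cons z x) =
      (H.W (x i) z * H.W z (x j)) * H.monomial E l x := by
    intro z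
    have h1 := H.monomial_image (Fin.succ_injective n) E l (Fin.cons z x)
    rw [show (Fin.cons z x : Fin (n + 1) → Ω) ∘ Fin.succ = x from by ext k; simp] at h1
    rw [← h1, monomial, monomial, Finset.prod_insert (by simp [hs, hij]),
      Finset.prod_insert (hs j)]
    simp [H.symm z (x i)]
    ring
  simp only [this, integral_mul_const]
  simp only [monomial, conv, List.map_cons, List.prod_cons]
  ring

theorem density_fromEdgeSet (H : Graphon Ω π) {n : ℕ} (E : Finset (Sym2 (Fin n)))
    (hE : ∀ e ∈ E, ¬ e.IsDiag) :
    H.density (SimpleGraph.fromEdgeSet (E : Set (Sym2 (Fin n)))) =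
      ∫ x, H.monomial E [] x ∂(Measure.pi fun _ => π) := by
  classical
  unfold density
  refine integral_congr_ae (Filter.Eventually.of_forall fun x => ?_)
  have : (SimpleGraph.fromEdgeSet (E : Set (Sym2 (Fin n)))).edgeFinset = E := by
    ext e
    simp only [SimpleGraph.mem_edgeFinset, SimpleGraph.edgeSet_fromEdgeSet, Set.mem_sdiff,
      Finset.mem_coe]
    exact ⟨fun h => h.1, fun h => ⟨h, hE e h⟩⟩
  simp only [monomial, List.map_nil, List.prod_nil, mul_one]
  refine Finset.prod_congr ?_ fun _ _ => rfl
  convert! this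

/-- The integrand of `Graphon.moment`. -/
noncomputable def momentKernel (H : Graphon Ω π) (t : Bool × List ℕ × List ℕ) (a : ℕ → Ω)
    (z w : Ω) : ℝ :=
  (if t.1 then H.W z w else 1) * ((t.2.1.map fun j => H.conv z (a j)).prod *
    (t.2.2.map fun j => H.conv w (a j)).prod)

/-- The anchored moment
`∫∫ W(z, w)^b ∏_{j ∈ l} conv(z, a_j) ∏_{j ∈ l'} conv(w, a_j) dπ(z) dπ(w)`. -/
noncomputable def moment (H : Graphon Ω π) (t : Bool × List ℕ × List ℕ) (a : ℕ → Ω) : ℝ :=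
  ∫ w, ∫ z, H.momentKernel t a z w ∂π ∂π

theorem bddMeasurable_momentKernel {H : Graphon Ω π}
    (hH : Measurable fun z : Ω × Ω => H.W z.1 z.2) (t : Bool × List ℕ × List ℕ) :
    BddMeasurable fun p : ((ℕ → Ω) × Ω) × Ω => H.momentKernel t p.1.1 p.2 p.1.2 := by
  refine BddMeasurable.mul ?_ (BddMeasurable.mul ?_ ?_)
  · by_cases h : t.1
    · simp only [h, if_true]
      exact (bddMeasurable_W hH).comp
        (g := fun p : ((ℕ → Ω) × Ω) × Ω => (p.2, p.1.2)) (by fun_prop)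
    · simpa [h] using BddMeasurable.const 1
  · exact BddMeasurable.list_prod (f := fun j (p : ((ℕ → Ω) × Ω) × Ω) => H.conv p.2 (p.1.1 j)) _
      fun j _ => (bddMeasurable_conv hH).comp
        (g := fun p : ((ℕ → Ω) × Ω) × Ω => (p.2, p.1.1 j)) (by fun_prop)
  · exact BddMeasurable.list_prod (f := fun j (p : ((ℕ → Ω) × Ω) × Ω) => H.conv p.1.2 (p.1.1 j)) _
      fun j _ => (bddMeasurable_conv hH).comp
        (g := fun p : ((ℕ → Ω) × Ω) × Ω => (p.1.2, p.1.1 j)) (by fun_prop)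

theorem bddMeasurable_moment {H : Graphon Ω π}
    (hH : Measurable fun z : Ω × Ω => H.W z.1 z.2) (t : Bool × List ℕ × List ℕ) :
    BddMeasurable (H.moment t) :=
  ((bddMeasurable_momentKernel hH t).integral_right π).integral_right π

theorem bddMeasurable_moment_prod {H : Graphon Ω π}
    (hH : Measurable fun z : Ω × Ω => H.W z.1 z.2) (T : List (Bool × List ℕ × List ℕ)) :
    BddMeasurable fun a => (T.map fun t => H.moment t a).prod :=
  BddMeasurable.list_prod T fun t _ => bddMeasurable_moment hH t

/-- An anchored moment can be absorbed into a monomial on two more vertices. -/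
theorem integral_monomial_mul_moment {H : Graphon Ω π}
    (hH : Measurable fun z : Ω × Ω => H.W z.1 z.2) {n : ℕ} (E : Finset (Sym2 (Fin n)))
    (l : List (Fin n × Fin n)) (c : ℕ → Fin n) (t : Bool × List ℕ × List ℕ)
    {P : (ℕ → Ω) → ℝ} (hP : BddMeasurable P) :
    ∫ x, H.monomial E l x * (H.moment t (x ∘ c) * P (x ∘ c)) ∂(Measure.pi fun _ => π) =
      ∫ x : Fin (n + 2) → Ω,
        H.monomial ((if t.1 then {s(0, 1)} else ∅) ∪ E.image (Sym2.map (Fin.succ ∘ Fin.succ)))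
          (t.2.1.map (fun j => (0, (c j).succ.succ)) ++
            (t.2.2.map (fun j => (1, (c j).succ.succ)) ++
              l.map (Prod.map (Fin.succ ∘ Fin.succ) (Fin.succ ∘ Fin.succ)))) x *
        P (x ∘ (Fin.succ ∘ Fin.succ ∘ c)) ∂(Measure.pi fun _ => π) := by
  have hPm : ∀ {m : ℕ} (c : ℕ → Fin m), BddMeasurable fun x : Fin m → Ω => P (x ∘ c) :=
    fun c => hP.comp (measurable_pi_lambda _ fun j => measurable_pi_apply _)
  have hb := (bddMeasurable_monomial hH
    ((if t.1 then {s(0, 1)} else ∅) ∪ E.image (Sym2.map (Fin.succ ∘ Fin.succ)))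
          (t.2.1.map (fun j => ((0 : Fin (n + 2)), (c j).succ.succ)) ++
            (t.2.2.map (fun j => (1, (c j).succ.succ)) ++
              l.map (Prod.map (Fin.succ ∘ Fin.succ) (Fin.succ ∘ Fin.succ))))).mul
    (hPm (Fin.succ ∘ Fin.succ ∘ c))
  have hdis : s((0 : Fin (n + 2)), 1) ∉ E.image (Sym2.map (Fin.succ ∘ Fin.succ)) := by
    intro hk
    obtain ⟨e, -, he⟩ := Finset.mem_image.1 hk
    induction e with
    | _ a b =>
      have := Sym2.mem_mk_left (0 : Fin (n + 2)) 1
      rw [← he, Sym2.map_mk, Sym2.mem_iff] at this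
      rcases this with h | h
      · exact Fin.succ_ne_zero _ h.symm
      · exact Fin.succ_ne_zero _ h.symm
  -- Vertices `0` and `1` carry the variables `z` and `w` of the moment; integrating them out
  -- recovers it.
  rw [integral_pi_fin_succ π hb,
    integral_pi_fin_succ π ((hb.comp measurable_fin_cons).integral_right π)]
  refine integral_congr_ae (Filter.Eventually.of_forall fun x => ?_)
  have key : ∀ z w : Ω, H.monomial
      ((if t.1 then {s(0, 1)} else ∅) ∪ E.image (Sym2.map (Fin.succ ∘ Fin.succ)))
          (t.2.1.map (fun j => ((0 : Fin (n + 2)), (c j).succ.succ)) ++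
            (t.2.2.map (fun j => (1, (c j).succ.succ)) ++
              l.map (Prod.map (Fin.succ ∘ Fin.succ) (Fin.succ ∘ Fin.succ))))
        (Fin.cons z (Fin.cons w x)) *
      P ((Fin.cons z (Fin.cons w x) : Fin (n + 2) → Ω) ∘ (Fin.succ ∘ Fin.succ ∘ c)) =
      H.momentKernel t (x ∘ c) z w * (H.monomial E l x * P (x ∘ c)) := by
    intro z w
    have hx : (Fin.cons z (Fin.cons w x) : Fin (n + 2) → Ω) ∘ (Fin.succ ∘ Fin.succ) = x := by
      ext k; simp
    have h1 := H.monomial_image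
      ((Fin.succ_injective (n + 1)).comp (Fin.succ_injective n)) E l (Fin.cons z (Fin.cons w x))
    rw [hx] at h1
    have h2 : (Fin.cons z (Fin.cons w x) : Fin (n + 2) → Ω) ∘ (Fin.succ ∘ Fin.succ ∘ c) =
      x ∘ c := by ext k; simp
    rw [h2, ← h1, monomial, monomial, momentKernel, Finset.prod_union (by
      split_ifs
      · simpa using hdis
      · simp)]
    have h3 : (Fin.cons z (Fin.cons w x) : Fin (n + 2) → Ω) 1 = w := rfl
    simp only [List.map_append, List.prod_append, List.map_map, Function.comp_def,
      Fin.cons_zero, Fin.cons_succ, h3]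
    split_ifs
    · simp only [Finset.prod_singleton, edgeValue_mk, Fin.cons_zero, h3]
      ring
    · simp only [Finset.prod_empty]
      ring
  simp only [key, integral_mul_const]
  rw [moment]
  ring

section Equality

variable {Ω' : Type*} [MeasurableSpace Ω'] {π' : Measure Ω'} [IsProbabilityMeasure π']
  {H : Graphon Ω π} {H' : Graphon Ω' π'}

/-- Trading the entries of `l` one by one for paths of length two leaves a simple graph. The set `E`
has no multiplicities, whereas the list `l` may repeat pairs: powers of `conv` are available, powers
of `W` are not. -/
theorem integral_monomial_eq (hH : Measurable fun z : Ω × Ω => H.W z.1 z.2)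
    (hH' : Measurable fun z : Ω' × Ω' => H'.W z.1 z.2)
    (hd : ∀ (k : ℕ) (F : SimpleGraph (Fin k)), H.density F = H'.density F) {n : ℕ}
    (E : Finset (Sym2 (Fin n))) (hE : ∀ e ∈ E, ¬ e.IsDiag) (l : List (Fin n × Fin n))
    (hl : ∀ p ∈ l, p.1 ≠ p.2) :
    ∫ x, H.monomial E l x ∂(Measure.pi fun _ => π) =
      ∫ x, H'.monomial E l x ∂(Measure.pi fun _ => π') := by
  obtain ⟨m, hm⟩ : ∃ m, l.length = m := ⟨_, rfl⟩
  induction m generalizing n E l with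
  | zero =>
    obtain rfl := List.length_eq_zero_iff.1 hm
    rw [← density_fromEdgeSet H E hE, ← density_fromEdgeSet H' E hE, hd]
  | succ m ih =>
    obtain ⟨⟨i, j⟩, l, rfl⟩ := List.exists_cons_of_length_eq_add_one hm
    have hij : i ≠ j := hl (i, j) (by simp)
    rw [integral_monomial_cons hH E hij l, integral_monomial_cons hH' E hij l]
    refine ih _ ?_ _ ?_ (by simpa using hm)
    · intro e he
      simp only [Finset.mem_insert, Finset.mem_image] at he
      rcases he with rfl | rfl | ⟨e, he, rfl⟩
      · simpa using (Fin.succ_ne_zero i).symm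
      · simpa using (Fin.succ_ne_zero j).symm
      · rw [Sym2.isDiag_map (Fin.succ_injective n)]
        exact hE e he
    · intro p hp
      obtain ⟨q, hq, rfl⟩ := List.mem_map.1 hp
      simpa using hl q (by simp [hq])

/-- Each moment is absorbed into the monomial at the cost of two vertices. The new pairs always join
a new vertex to an old one or the two new ones to each other, so no loop arises. -/
theorem integral_monomial_mul_moments_eq (hH : Measurable fun z : Ω × Ω => H.W z.1 z.2)
    (hH' : Measurable fun z : Ω' × Ω' => H'.W z.1 z.2)
    (hd : ∀ (k : ℕ) (F : SimpleGraph (Fin k)), H.density F = H'.density F) {n : ℕ}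
    (E : Finset (Sym2 (Fin n))) (hE : ∀ e ∈ E, ¬ e.IsDiag) (l : List (Fin n × Fin n))
    (hl : ∀ p ∈ l, p.1 ≠ p.2) (c : ℕ → Fin n) (T : List (Bool × List ℕ × List ℕ)) :
    ∫ x, H.monomial E l x * (T.map fun t => H.moment t (x ∘ c)).prod ∂(Measure.pi fun _ => π) =
      ∫ x, H'.monomial E l x * (T.map fun t => H'.moment t (x ∘ c)).prod
        ∂(Measure.pi fun _ => π') := by
  induction T generalizing n with
  | nil => simpa using integral_monomial_eq hH hH' hd E hE l hl
  | cons t T ih =>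
    simp only [List.map_cons, List.prod_cons]
    rw [integral_monomial_mul_moment hH E l c t (bddMeasurable_moment_prod hH T),
      integral_monomial_mul_moment hH' E l c t (bddMeasurable_moment_prod hH' T)]
    refine ih _ ?_ _ ?_ _
    · intro e he
      rcases Finset.mem_union.1 he with he | he
      · split_ifs at he
        · rw [Finset.mem_singleton.1 he]
          simp
        · simp at he
      · obtain ⟨e, he', rfl⟩ := Finset.mem_image.1 he
        rw [Sym2.isDiag_map ((Fin.succ_injective _).comp (Fin.succ_injective n))]
        exact hE e he'
    · intro p hp
      simp only [List.mem_append, List.mem_map] at hp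
      rcases hp with ⟨j, -, rfl⟩ | ⟨j, -, rfl⟩ | ⟨q, hq, rfl⟩
      · exact (Fin.succ_ne_zero (c j).succ).symm
      · exact fun h => Fin.succ_ne_zero (c j)
          (Fin.succ_injective (n + 1) (show Fin.succ 0 = (c j).succ.succ from h)).symm
      · simpa using hl q hq

/-- The first coordinates of an infinite product. -/
theorem measurePreserving_infinitePi_fin (n : ℕ) :
    MeasurePreserving (fun (a : ℕ → Ω) (i : Fin n) => a i) (Measure.infinitePi fun _ : ℕ => π)
      (Measure.pi fun _ => π) := by
  have hm : Measurable fun (a : ℕ → Ω) (i : Fin n) => a i := by fun_prop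
  refine ⟨hm, (Measure.pi_eq fun s hs => ?_).symm⟩
  rw [Measure.map_apply hm (MeasurableSet.univ_pi hs)]
  have h := Measure.infinitePi_pi (fun _ : ℕ => π) (s := Finset.range n)
    (t := fun i => if h : i < n then s ⟨i, h⟩ else Set.univ) (fun i _ => by
      split_ifs
      · exact hs _
      · exact MeasurableSet.univ)
  rw [Finset.prod_range] at h
  simp only [Fin.is_lt, dite_true] at h
  rw [← h]
  congr 1
  ext a
  simp only [Set.mem_preimage, Set.mem_pi, Set.mem_univ, true_imp_iff, Finset.coe_range,
    Set.mem_Iio]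
  exact ⟨fun h i hi => by simpa [hi] using h ⟨i, hi⟩, fun h i => by simpa using h i i.2⟩

/-- Finitely many moments see only anchors of index at most `N`. `Fin.ofNat (N + 1)` reduces indices
modulo `N + 1`, hence fixes these, and the factor `H.monomial ∅ []` is `1`, present to match
`integral_monomial_mul_moments_eq`. -/
theorem integral_moments_infinitePi (hH : Measurable fun z : Ω × Ω => H.W z.1 z.2)
    (T : List (Bool × List ℕ × List ℕ)) {N : ℕ} (hN : ∀ t ∈ T, ∀ j ∈ t.2.1 ++ t.2.2, j ≤ N) :
    ∫ a, (T.map fun t => H.moment t a).prod ∂(Measure.infinitePi fun _ : ℕ => π) =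
      ∫ x : Fin (N + 1) → Ω, H.monomial ∅ [] x *
        (T.map fun t => H.moment t (x ∘ Fin.ofNat (N + 1))).prod ∂(Measure.pi fun _ => π) := by
  have hb := (bddMeasurable_moment_prod hH T).comp (g := fun x : Fin (N + 1) → Ω =>
    x ∘ Fin.ofNat (N + 1)) (measurable_pi_lambda _ fun j => measurable_pi_apply _)
  have hmp := measurePreserving_infinitePi_fin (π := π) (N + 1)
  simp only [monomial, Finset.prod_empty, List.map_nil, List.prod_nil, one_mul]
  rw [← hmp.map_eq, integral_map hmp.measurable.aemeasurable
    hb.measurable.aestronglyMeasurable]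
  refine integral_congr_ae (Filter.Eventually.of_forall fun a => ?_)
  refine congrArg List.prod (List.map_congr_left fun t ht => ?_)
  have ha : ∀ j ∈ t.2.1 ++ t.2.2, a (Fin.ofNat (N + 1) j) = a j := fun j hj => by
    rw [Fin.val_ofNat, Nat.mod_eq_of_lt (Nat.lt_succ_of_le (hN t ht j hj))]
  unfold moment momentKernel
  have h1 : ∀ z, (t.2.1.map fun j => H.conv z (a j)) =
      t.2.1.map fun j => H.conv z (a (Fin.ofNat (N + 1) j)) := fun z =>
    List.map_congr_left fun j hj => by rw [ha j (List.mem_append_left _ hj)]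
  have h2 : ∀ z, (t.2.2.map fun j => H.conv z (a j)) =
      t.2.2.map fun j => H.conv z (a (Fin.ofNat (N + 1) j)) := fun z =>
    List.map_congr_left fun j hj => by rw [ha j (List.mem_append_right _ hj)]
  simp only [h1, h2]
  rfl

/-- Joint moments of the anchored moments, for a random sequence of anchors, are determined by
the densities. -/
theorem integral_moments_eq (hH : Measurable fun z : Ω × Ω => H.W z.1 z.2)
    (hH' : Measurable fun z : Ω' × Ω' => H'.W z.1 z.2)
    (hd : ∀ (k : ℕ) (F : SimpleGraph (Fin k)), H.density F = H'.density F)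
    (T : List (Bool × List ℕ × List ℕ)) :
    ∫ a, (T.map fun t => H.moment t a).prod ∂(Measure.infinitePi fun _ : ℕ => π) =
      ∫ a, (T.map fun t => H'.moment t a).prod ∂(Measure.infinitePi fun _ : ℕ => π') := by
  obtain ⟨N, hN⟩ : ∃ N : ℕ, ∀ t ∈ T, ∀ j ∈ t.2.1 ++ t.2.2, j ≤ N :=
    ⟨(T.flatMap fun t => t.2.1 ++ t.2.2).toFinset.sup id, fun t ht j hj =>
      Finset.le_sup (f := id) (by
        rw [List.mem_toFinset, List.mem_flatMap]
        exact ⟨t, ht, hj⟩)⟩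
  rw [integral_moments_infinitePi hH T hN, integral_moments_infinitePi hH' T hN]
  exact integral_monomial_mul_moments_eq hH hH' hd ∅ (by simp) [] (by simp) _ T

end Equality

end Graphon

/-! ### Random anchors and the factorization of the graphon -/

/-- Functions whose squared distances to `f` are summable converge to `f` almost everywhere. -/
theorem ae_tendsto_of_integral_sq_lt {α : Type*} [MeasurableSpace α] {μ : Measure α}
    {g : ℕ → α → ℝ} {f : α → ℝ} (hi : ∀ k, Integrable (fun x => (g k x - f x) ^ 2) μ)
    (h : ∀ k, ∫ x, (g k x - f x) ^ 2 ∂μ < (1 / 2) ^ k) :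
    ∀ᵐ x ∂μ, Filter.Tendsto (fun k => g k x) Filter.atTop (nhds (f x)) := by
  have hm : ∀ k, AEMeasurable (fun x => ENNReal.ofReal ((g k x - f x) ^ 2)) μ := fun k =>
    (hi k).aestronglyMeasurable.aemeasurable.ennreal_ofReal
  have h1 : ∫⁻ x, ∑' k, ENNReal.ofReal ((g k x - f x) ^ 2) ∂μ ≠ ⊤ := by
    rw [lintegral_tsum hm]
    have h2 : ∀ k, ∫⁻ x, ENNReal.ofReal ((g k x - f x) ^ 2) ∂μ ≤
        ENNReal.ofReal ((1 / 2) ^ k) := fun k => by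
      rw [← ofReal_integral_eq_lintegral_ofReal (hi k)
        (Filter.Eventually.of_forall fun x => sq_nonneg _)]
      exact ENNReal.ofReal_le_ofReal (h k).le
    refine ne_top_of_le_ne_top ?_ (ENNReal.tsum_le_tsum h2)
    rw [← ENNReal.ofReal_tsum_of_nonneg (fun k => by positivity) summable_geometric_two]
    exact ENNReal.ofReal_ne_top
  filter_upwards [ae_lt_top' (AEMeasurable.tsum hm) h1] with x hx
  have h3 := ENNReal.tendsto_atTop_zero_of_tsum_ne_top hx.ne
  have h4 := (ENNReal.tendsto_toReal ENNReal.zero_ne_top).comp h3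
  simp only [Function.comp_def, ENNReal.toReal_ofReal (sq_nonneg _), ENNReal.toReal_zero] at h4
  have h5 := h4.sqrt
  simp only [Real.sqrt_sq_eq_abs, Real.sqrt_zero] at h5
  rw [tendsto_iff_norm_sub_tendsto_zero]
  exact h5

theorem ae_prod_of_ae_ae {α : Type*} [MeasurableSpace α] {μ : Measure α} [SFinite μ]
    {p : α → α → Prop} (hp : MeasurableSet {z : α × α | p z.1 z.2})
    (h : ∀ᵐ y ∂μ, ∀ᵐ x ∂μ, p x y) : ∀ᵐ z ∂μ.prod μ, p z.1 z.2 := by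
  rw [Measure.ae_prod_iff_ae_ae hp]
  exact (Measure.ae_ae_comm hp).2 h

namespace Graphon

variable {Ω : Type*} [MeasurableSpace Ω] {π : Measure Ω} [IsProbabilityMeasure π]

/-- If `W(x, y)` depends on `y` only through `φ y`, then it depends on `x` and `y` only through
`φ x` and `φ y`. -/
theorem exists_factor_of_factor_right [StandardBorelSpace Ω] {H : Graphon Ω π}
    (hH : Measurable fun z : Ω × Ω => H.W z.1 z.2) {K : Type*} [MeasurableSpace K] {φ : Ω → K}
    (hφ : Measurable φ) {L : Ω × K → ℝ} (hL : Measurable L)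
    (h : ∀ᵐ z ∂π.prod π, H.W z.1 z.2 = L (z.1, φ z.2)) :
    ∃ U : K × K → ℝ, Measurable U ∧ ∀ᵐ z ∂π.prod π, H.W z.1 z.2 = U (φ z.1, φ z.2) := by
  have := nonempty_of_isProbabilityMeasure π
  -- By symmetry, `L (x, φ y) = L (y, φ x)` for almost all `x`. Given `φ x = u`, the left side is
  -- thus almost surely the constant `L (y, u)`, hence equal to its conditional mean, which involves
  -- only `u` and `φ y`.
  let κ := ProbabilityTheory.condDistrib id φ π
  have hU : Measurable fun p : K × K => ∫ z, L (z, p.2) ∂(κ p.1) := by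
    have hm : Measurable fun q : (K × K) × Ω => L (q.2, q.1.2) := by fun_prop
    exact (hm.stronglyMeasurable.integral_kernel_prod_right'
      (κ := ProbabilityTheory.Kernel.prodMkRight K κ)).measurable
  refine ⟨_, hU, ae_prod_of_ae_ae
    (p := fun x y => H.W x y = ∫ z, L (z, φ y) ∂(κ (φ x))) (measurableSet_eq_fun hH
    (hU.comp ((hφ.comp measurable_fst).prodMk (hφ.comp measurable_snd)))) ?_⟩
  have hs : ∀ᵐ z ∂π.prod π, H.W z.2 z.1 = L (z.2, φ z.1) :=
    (Measure.measurePreserving_swap (μ := π) (ν := π)).quasiMeasurePreserving.ae h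
  filter_upwards [Measure.ae_ae_of_ae_prod h, Measure.ae_ae_of_ae_prod hs] with y h1 h2
  have h3 : ∀ᵐ x ∂π, L (x, φ y) = L (y, φ x) := by
    filter_upwards [h1, h2] with x h1 h2
    rw [← h1, ← h2, H.symm]
  have h4 : ∀ᵐ p ∂(π.map fun x => (φ x, id x)), L (p.2, φ y) = L (y, p.1) := by
    rw [ae_map_iff (by fun_prop) (measurableSet_eq_fun (by fun_prop) (by fun_prop))]
    exact h3
  rw [← ProbabilityTheory.compProd_map_condDistrib aemeasurable_id] at h4
  have h5 : ∀ᵐ u ∂(π.map φ), ∫ z, L (z, φ y) ∂(κ u) = L (y, u) := by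
    filter_upwards [Measure.ae_ae_of_ae_compProd h4] with u hu
    rw [integral_congr_ae hu]
    simp
  filter_upwards [ae_of_ae_map hφ.aemeasurable h5, h1] with x h6 h7
  rw [h6, H.symm, h7]

/-- The squared `L²`-distance of two sections. -/
noncomputable def sectionDist (H : Graphon Ω π) (y z : Ω) : ℝ :=
  ∫ x, (H.W x y - H.W x z) ^ 2 ∂π

/-- Expanding the square shows that values of `conv` determine distances of sections. -/
theorem sectionDist_eq {H : Graphon Ω π} (hH : Measurable fun z : Ω × Ω => H.W z.1 z.2)
    (y z : Ω) : H.sectionDist y z = H.conv y y - 2 * H.conv y z + H.conv z z := by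
  have hi : ∀ u v : Ω, Integrable (fun x => H.W u x * H.W x v) π := fun u v =>
    (((bddMeasurable_W hH).comp (g := fun x => (u, x)) (by fun_prop)).mul
      ((bddMeasurable_W hH).comp (g := fun x => (x, v)) (by fun_prop))).integrable π
  have : ∀ x, (H.W x y - H.W x z) ^ 2 =
      H.W y x * H.W x y - 2 * (H.W y x * H.W x z) + H.W z x * H.W x z := fun x => by
    rw [H.symm y x, H.symm z x]; ring
  simp only [sectionDist, conv, this]
  rw [integral_add (by exact (hi y y).sub ((hi y z).const_mul 2)) (hi z z),
    integral_sub (hi y y) ((hi y z).const_mul 2), integral_const_mul]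

theorem bddMeasurable_section {H : Graphon Ω π}
    (hH : Measurable fun z : Ω × Ω => H.W z.1 z.2) (y : Ω) : BddMeasurable fun x => H.W x y :=
  (bddMeasurable_W hH).comp (g := fun x => (x, y)) (by fun_prop)

theorem measurable_sectionDist {H : Graphon Ω π}
    (hH : Measurable fun z : Ω × Ω => H.W z.1 z.2) :
    Measurable fun p : Ω × Ω => H.sectionDist p.1 p.2 := by
  have h := (bddMeasurable_conv hH).measurable
  simp only [sectionDist_eq hH]
  exact ((h.comp (measurable_fst.prodMk measurable_fst)).sub (h.const_mul 2)).add
    (h.comp (measurable_snd.prodMk measurable_snd))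

/-- Almost every section has sections in a set of positive measure close to it. -/
theorem ae_measure_sectionDist_lt_ne_zero [StandardBorelSpace Ω] {H : Graphon Ω π}
    (hH : Measurable fun z : Ω × Ω => H.W z.1 z.2) {ε : ℝ} (hε : 0 < ε) :
    ∀ᵐ y ∂π, π {z | H.sectionDist y z < ε} ≠ 0 := by
  obtain ⟨C, hC⟩ := H.bounded
  have hC0 : 0 ≤ C := by
    obtain ⟨x⟩ := nonempty_of_isProbabilityMeasure π
    exact (abs_nonneg _).trans (hC x x)
  have hmem : ∀ y, MemLp (fun x => H.W x y) 1 π := fun y =>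
    memLp_one_iff_integrable.2 ((bddMeasurable_section hH y).integrable π)
  let F : Ω → Lp ℝ 1 π := fun y => (hmem y).toLp
  have hD : ∀ y z, H.sectionDist y z ≤ 2 * C * dist (F y) (F z) := fun y z => by
    have hd : dist (F y) (F z) = ∫ x, |H.W x y - H.W x z| ∂π := by
      rw [L1.dist_eq_integral_dist]
      refine integral_congr_ae ?_
      filter_upwards [(hmem y).coeFn_toLp, (hmem z).coeFn_toLp] with x h1 h2
      simp only [F, h1, h2, Real.dist_eq]
    rw [hd, sectionDist, ← integral_const_mul]
    have hi := ((bddMeasurable_section hH y).integrable π).sub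
      ((bddMeasurable_section hH z).integrable π)
    refine integral_mono_of_nonneg (Filter.Eventually.of_forall fun x => sq_nonneg _)
      (hi.abs.const_mul _) (Filter.Eventually.of_forall fun x => ?_)
    have h2 : |H.W x y - H.W x z| ≤ 2 * C :=
      (abs_sub _ _).trans (by linarith [hC x y, hC x z])
    calc (H.W x y - H.W x z) ^ 2 = |H.W x y - H.W x z| * |H.W x y - H.W x z| := by
          rw [abs_mul_abs_self, sq]
      _ ≤ 2 * C * |H.W x y - H.W x z| := mul_le_mul_of_nonneg_right h2 (abs_nonneg _)
  have : Fact ((1 : ℝ≥0∞) ≠ ⊤) := ⟨ENNReal.one_ne_top⟩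
  -- Separability of `L¹` suffices: every exceptional `y` lies in the preimage of a ball about a
  -- point of `S` with null preimage, and there are countably many such balls. Measurability of `F`
  -- plays no role.
  obtain ⟨S, hS, hSd⟩ := TopologicalSpace.exists_countable_dense (Lp ℝ 1 π)
  -- Two points of one `δ`-ball are less than `2 * δ` apart in `L¹`, so their squared `L²`-distance
  -- is at most `4 * C * δ < ε`.
  set δ := ε / (4 * (C + 1)) with hδ
  have hδ0 : 0 < δ := by positivity
  have hnull : π (⋃ c ∈ {c ∈ S | π (F ⁻¹' Metric.ball c δ) = 0}, F ⁻¹' Metric.ball c δ) = 0 :=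
    (measure_biUnion_null_iff (hS.mono fun c hc => hc.1)).2 fun c hc => hc.2
  refine measure_mono_null (fun y hy => ?_) hnull
  have hy' : π {z | H.sectionDist y z < ε} = 0 := by simpa using hy
  obtain ⟨c, hcS, hc⟩ := hSd.exists_dist_lt (F y) hδ0
  refine Set.mem_biUnion ⟨hcS, measure_mono_null (fun z hz => ?_) hy'⟩ hc
  have h1 : dist (F y) (F z) < δ + δ :=
    (dist_triangle_right _ _ c).trans_lt (add_lt_add hc hz)
  calc H.sectionDist y z ≤ 2 * C * dist (F y) (F z) := hD y z
    _ ≤ 2 * C * (δ + δ) := by gcongr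
    _ < 4 * (C + 1) * δ := by nlinarith
    _ = ε := by rw [hδ]; field_simp

/-- A random sequence visits a set of positive measure almost surely. -/
theorem ae_infinitePi_exists_mem {S : Set Ω} (hS : MeasurableSet S) (h0 : π S ≠ 0) :
    ∀ᵐ a ∂(Measure.infinitePi fun _ : ℕ => π), ∃ j, a j ∈ S := by
  have h1 : π Sᶜ < 1 := by
    rw [prob_compl_eq_one_sub hS]
    exact ENNReal.sub_lt_self ENNReal.one_ne_top one_ne_zero h0
  -- Missing `S` forever entails missing it in the first `n` independent trials.
  have h2 : ∀ n : ℕ, (Measure.infinitePi fun _ : ℕ => π) {a | ¬ ∃ j, a j ∈ S} ≤ π Sᶜ ^ n := by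
    intro n
    have := Measure.infinitePi_pi (fun _ : ℕ => π) (s := Finset.range n) (t := fun _ => Sᶜ)
      (fun _ _ => hS.compl)
    simp only [Finset.prod_const, Finset.card_range] at this
    rw [← this]
    exact measure_mono fun a ha i _ hi => ha ⟨i, hi⟩
  exact le_antisymm (ge_of_tendsto' (ENNReal.tendsto_pow_atTop_nhds_zero_of_lt_one h1) h2)
    zero_le

/-- By Fubini `y` may be fixed before the anchors. For almost every `y` the balls about its section
have positive measure, so a random sequence visits all of them. -/
theorem ae_infinitePi_dense [StandardBorelSpace Ω] {H : Graphon Ω π}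
    (hH : Measurable fun z : Ω × Ω => H.W z.1 z.2) :
    ∀ᵐ a ∂(Measure.infinitePi fun _ : ℕ => π), ∀ᵐ y ∂π,
      ∀ k : ℕ, ∃ j, H.sectionDist y (a j) < (1 / 2) ^ k := by
  have hD := measurable_sectionDist hH
  have hm : MeasurableSet {p : Ω × (ℕ → Ω) |
      ∀ k : ℕ, ∃ j, H.sectionDist p.1 (p.2 j) < (1 / 2) ^ k} := by
    simp only [Set.ofPred_forall, Set.ofPred_exists]
    refine MeasurableSet.iInter fun k => MeasurableSet.iUnion fun j => ?_
    exact measurableSet_lt (hD.comp (g := fun p : Ω × Ω => H.sectionDist p.1 p.2)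
      (f := fun p : Ω × (ℕ → Ω) => (p.1, p.2 j)) (by fun_prop)) measurable_const
  rw [← Measure.ae_ae_comm hm]
  have : ∀ᵐ y ∂π, ∀ k : ℕ, π {z | H.sectionDist y z < (1 / 2) ^ k} ≠ 0 :=
    ae_all_iff.2 fun k => ae_measure_sectionDist_lt_ne_zero hH (by positivity)
  filter_upwards [this] with y hy
  refine ae_all_iff.2 fun k => ae_infinitePi_exists_mem ?_ (hy k)
  exact measurableSet_lt (hD.comp (by fun_prop : Measurable fun z => (y, z))) measurable_const

/-- The map `x ↦ (conv(x, a_j))_j` into the space of sequences. -/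
noncomputable def anchorMap (H : Graphon Ω π) (a : ℕ → Ω) (x : Ω) : ℕ → ℝ :=
  fun j => H.conv x (a j)

theorem measurable_anchorMap {H : Graphon Ω π} (hH : Measurable fun z : Ω × Ω => H.W z.1 z.2)
    (a : ℕ → Ω) : Measurable (H.anchorMap a) :=
  measurable_pi_lambda _ fun j => (bddMeasurable_conv hH).measurable.comp
    (by fun_prop : Measurable fun x => (x, a j))

/-- The difference of `conv y y` and the `j`-th term is `sectionDist y (a j)`, which is nonnegative
with infimum `0`. The squared norm of the section at `y`, and so its distance to every anchor, can
be read off from the anchor map. -/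
theorem iSup_anchorMap {H : Graphon Ω π} (hH : Measurable fun z : Ω × Ω => H.W z.1 z.2)
    {a : ℕ → Ω} {y : Ω} (hy : ∀ k : ℕ, ∃ j, H.sectionDist y (a j) < (1 / 2) ^ k) :
    ⨆ j, (2 * H.anchorMap a y j - H.conv (a j) (a j)) = H.conv y y := by
  have hle : ∀ j, 2 * H.anchorMap a y j - H.conv (a j) (a j) ≤ H.conv y y := fun j => by
    have h0 : 0 ≤ H.sectionDist y (a j) := integral_nonneg fun x => sq_nonneg _
    rw [sectionDist_eq hH] at h0
    simp only [anchorMap]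
    linarith
  refine ciSup_eq_of_forall_le_of_forall_lt_exists_gt hle fun w hw => ?_
  obtain ⟨k, hk⟩ := exists_pow_lt_of_lt_one (sub_pos.2 hw) (by norm_num : (1 / 2 : ℝ) < 1)
  obtain ⟨j, hj⟩ := hy k
  rw [sectionDist_eq hH] at hj
  exact ⟨j, by simp only [anchorMap]; linarith⟩

open scoped Classical in
/-- For almost every sequence of anchors, the graphon factors through the anchor map. -/
theorem ae_exists_factor_anchorMap [StandardBorelSpace Ω] {H : Graphon Ω π}
    (hH : Measurable fun z : Ω × Ω => H.W z.1 z.2) :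
    ∀ᵐ a ∂(Measure.infinitePi fun _ : ℕ => π), ∃ U : (ℕ → ℝ) × (ℕ → ℝ) → ℝ, Measurable U ∧
      ∀ᵐ z ∂π.prod π, H.W z.1 z.2 = U (H.anchorMap a z.1, H.anchorMap a z.2) := by
  filter_upwards [ae_infinitePi_dense hH] with a ha
  let s : (ℕ → ℝ) → ℝ := fun v => ⨆ j, (2 * v j - H.conv (a j) (a j))
  have hs : Measurable s := Measurable.iSup fun j => by fun_prop
  let p : ℕ → (ℕ → ℝ) → ℕ → Prop := fun k v j => s v - 2 * v j + H.conv (a j) (a j) < (1 / 2) ^ k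
  -- The second alternative makes the search total; it returns index `0` when no anchor is close
  -- enough.
  have hp : ∀ k v, ∃ j, p k v j ∨ ∀ i, ¬ p k v i := fun k v => by
    by_cases h : ∃ j, p k v j
    · exact h.imp fun j hj => Or.inl hj
    · exact ⟨0, Or.inr (not_exists.1 h)⟩
  have hpm : ∀ k j, MeasurableSet {v | p k v j} := fun k j =>
    measurableSet_lt (by fun_prop) measurable_const
  let J : ℕ → (ℕ → ℝ) → ℕ := fun k v => Nat.find (hp k v)
  have hJ : ∀ k, Measurable (J k) := fun k => measurable_find _ fun j => by
    have h1 : MeasurableSet (⋂ i, {v | p k v i}ᶜ) :=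
      MeasurableSet.iInter fun i => (hpm k i).compl
    convert! (hpm k j).union h1 using 1
    ext v
    simp
  -- `J k` picks the first anchor whose section is within squared distance `(1 / 2) ^ k`. These
  -- bounds are summable, so the chosen sections converge almost everywhere; `limsup` is a
  -- measurable stand-in for the limit.
  let L : Ω × (ℕ → ℝ) → ℝ := fun q => Filter.limsup (fun k => H.W q.1 (a (J k q.2))) Filter.atTop
  have hL : Measurable L := Measurable.limsup fun k => by
    have h1 : Measurable fun q : Ω × ℕ => H.W q.1 (a q.2) :=
      measurable_from_prod_countable_left fun j => (bddMeasurable_section hH (a j)).measurable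
    exact h1.comp (g := fun q : Ω × ℕ => H.W q.1 (a q.2))
      (f := fun q : Ω × (ℕ → ℝ) => (q.1, J k q.2)) (by fun_prop)
  have hφ := measurable_anchorMap hH a
  refine exists_factor_of_factor_right hH hφ hL
    (ae_prod_of_ae_ae (p := fun x y => H.W x y = L (x, H.anchorMap a y)) (measurableSet_eq_fun hH
      (hL.comp (measurable_fst.prodMk (hφ.comp measurable_snd)))) ?_)
  filter_upwards [ha] with y hy
  have hJy : ∀ k, ∫ x, (H.W x (a (J k (H.anchorMap a y))) - H.W x y) ^ 2 ∂π < (1 / 2) ^ k := by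
    intro k
    have hpk : ∀ j, p k (H.anchorMap a y) j ↔ H.sectionDist y (a j) < (1 / 2) ^ k := fun j => by
      simp only [p, s, iSup_anchorMap hH hy, sectionDist_eq hH]
      rfl
    have h1 : p k (H.anchorMap a y) (J k (H.anchorMap a y)) := by
      rcases Nat.find_spec (hp k (H.anchorMap a y)) with h | h
      · exact h
      · obtain ⟨j, hj⟩ := hy k
        exact absurd ((hpk j).2 hj) (h j)
    refine lt_of_eq_of_lt ?_ ((hpk _).1 h1)
    exact integral_congr_ae (Filter.Eventually.of_forall fun x => by ring)
  have hi : ∀ z, Integrable (fun x => (H.W x z - H.W x y) ^ 2) π := fun z => by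
    have h1 := bddMeasurable_section hH z
    have h2 := bddMeasurable_section hH y
    have := ((h1.mul h1).integrable π).sub
      ((((h1.mul h2).integrable π).const_mul 2).sub ((h2.mul h2).integrable π))
    refine this.congr (Filter.Eventually.of_forall fun x => ?_)
    simp only [Pi.sub_apply]; ring
  filter_upwards [ae_tendsto_of_integral_sq_lt (fun k => hi _) hJy] with x hx
  exact hx.limsup_eq.symm

end Graphon

/-! ### Determination by moments and a coupling -/

/-- Finite measures with bounded coordinates and the same mixed moments are equal. -/
theorem MeasureTheory.Measure.ext_of_forall_integral_list_prod_eq {ι : Type*} [Countable ι]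
    {μ ν : Measure (ι → ℝ)} [IsFiniteMeasure μ] [IsFiniteMeasure ν] (B : ι → ℝ)
    (hμ : ∀ᵐ x ∂μ, ∀ i, |x i| ≤ B i) (hν : ∀ᵐ x ∂ν, ∀ i, |x i| ≤ B i)
    (h : ∀ l : List ι, ∫ x, (l.map x).prod ∂μ = ∫ x, (l.map x).prod ∂ν) : μ = ν := by
  classical
  -- Clipping moves both measures to a compact cube without loss. There the coordinates separate
  -- points, and the algebra they generate is spanned by products over lists, so Stone–Weierstrass
  -- applies. Absolute values keep the intervals nonempty.
  let Q := ∀ i, Set.Icc (-|B i|) |B i|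
  let c : (ι → ℝ) → Q := fun x i => Set.projIcc _ _ (neg_le_self (abs_nonneg (B i))) (x i)
  let v : Q → ι → ℝ := fun x i => x i
  have hc : Measurable c := measurable_pi_lambda _ fun i =>
    continuous_projIcc.measurable.comp (measurable_pi_apply i)
  have hv : Measurable v := measurable_pi_lambda _ fun i =>
    measurable_subtype_coe.comp (measurable_pi_apply i)
  have hvc : ∀ {ξ : Measure (ι → ℝ)}, (∀ᵐ x ∂ξ, ∀ i, |x i| ≤ B i) → v ∘ c =ᵐ[ξ] id := by
    intro ξ hξ
    filter_upwards [hξ] with x hx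
    ext i
    have hm : x i ∈ Set.Icc (-|B i|) |B i| := abs_le.1 ((hx i).trans (le_abs_self _))
    simp only [Function.comp_apply, v, c, Set.projIcc_of_mem _ hm, id]
  have hback : ∀ {ξ : Measure (ι → ℝ)}, (∀ᵐ x ∂ξ, ∀ i, |x i| ≤ B i) → (ξ.map c).map v = ξ := by
    intro ξ hξ
    rw [Measure.map_map hv hc, Measure.map_congr (hvc hξ), Measure.map_id]
  suffices hQ : μ.map c = ν.map c by rw [← hback hμ, ← hback hν, hQ]
  let e : ι → BoundedContinuousFunction Q ℝ := fun i =>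
    BoundedContinuousFunction.mkOfCompact ⟨fun x => (x i : ℝ), by fun_prop⟩
  have hint : ∀ {ξ : Measure (ι → ℝ)}, (∀ᵐ x ∂ξ, ∀ i, |x i| ≤ B i) → ∀ l : List ι,
      ∫ x, (l.map e).prod x ∂(ξ.map c) = ∫ x, (l.map x).prod ∂ξ := by
    intro ξ hξ l
    rw [integral_map hc.aemeasurable
      (BoundedContinuousFunction.continuous _).measurable.aestronglyMeasurable]
    refine integral_congr_ae ?_
    filter_upwards [hvc hξ] with x hx
    have h1 : ∀ y : Q, (l.map e).prod y = (l.map (v y)).prod := fun y => by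
      induction l with
      | nil => simp
      | cons i l ih => simp [ih, e, v]
    rw [h1]
    exact congrArg (fun y : ι → ℝ => (l.map y).prod) hx
  let A : StarSubalgebra ℝ (BoundedContinuousFunction Q ℝ) :=
    StarAlgebra.adjoin ℝ (Set.range e)
  refine ext_of_forall_mem_subalgebra_integral_eq_of_polish (𝕜 := ℝ) (A := A) ?_ ?_
  · intro x y hxy
    obtain ⟨i, hi⟩ := Function.ne_iff.1 hxy
    refine ⟨fun x => (x i : ℝ), ⟨(e i).toContinuousMap, ?_, rfl⟩, fun h => hi (Subtype.ext h)⟩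
    exact ⟨e i, StarAlgebra.subset_adjoin ℝ _ ⟨i, rfl⟩, rfl⟩
  · intro g hg
    have hstar : star (Set.range e) = Set.range e := by
      ext g
      rw [Set.mem_star, show star g = g from BoundedContinuousFunction.ext fun x => rfl]
    have hg' : g ∈ Submodule.span ℝ (Submonoid.closure (Set.range e) : Set _) := by
      rw [← Algebra.adjoin_eq_span]
      have : g ∈ A.toSubalgebra := hg
      rw [StarAlgebra.adjoin_toSubalgebra, hstar, Set.union_self] at this
      exact this
    have hcm : IsFiniteMeasure (μ.map c) := inferInstance
    have hcn : IsFiniteMeasure (ν.map c) := inferInstance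
    clear hg
    induction hg' using Submodule.span_induction with
    | mem g hg =>
      obtain ⟨l, hl, rfl⟩ := Submonoid.exists_list_of_mem_closure hg
      obtain ⟨l, rfl⟩ : ∃ l' : List ι, l = l'.map e := by
        induction l with
        | nil => exact ⟨[], rfl⟩
        | cons f l ih =>
          obtain ⟨l', rfl⟩ := ih (fun x hx => hl x (by simp [hx])) (Submonoid.list_prod_mem _
            fun x hx => Submonoid.subset_closure (hl x (by simp [hx])))
          obtain ⟨i, rfl⟩ := hl f (by simp)
          exact ⟨i :: l', rfl⟩
      rw [hint hμ, hint hν, h]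
    | zero => simp
    | add f g _ _ hf hg =>
      simp only [BoundedContinuousFunction.coe_add, Pi.add_apply]
      rw [integral_add (f.integrable _) (g.integrable _), integral_add (f.integrable _)
        (g.integrable _), hf, hg]
    | smul r f _ hf =>
      simp only [BoundedContinuousFunction.coe_smul, smul_eq_mul, integral_const_mul, hf]

/-- Almost every value of a random variable is taken at a point of a given set of full measure. -/
theorem ae_map_exists_eq {α S : Type*} [MeasurableSpace α] [StandardBorelSpace α]
    [MeasurableSpace S] [StandardBorelSpace S] {μ : Measure α} [IsProbabilityMeasure μ]
    {f : α → S} (hf : Measurable f) {p : α → Prop} (hp : ∀ᵐ x ∂μ, p x) :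
    ∀ᵐ s ∂(μ.map f), ∃ x, p x ∧ f x = s := by
  have := nonempty_of_isProbabilityMeasure μ
  obtain ⟨t, ht, htm, ht0⟩ := exists_measurable_superset_of_null hp
  -- The image of the good set need not be measurable, so the law is disintegrated instead: for
  -- almost every `s` the conditional law given `f = s` is carried by good points of the fibre,
  -- which therefore exist.
  have h1 : ∀ᵐ q ∂(μ.map fun x => (f x, id x)), q.2 ∈ tᶜ ∧ f q.2 = q.1 := by
    have hm : MeasurableSet {q : S × α | q.2 ∈ tᶜ ∧ f q.2 = q.1} :=
      (measurable_snd htm.compl).inter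
        (measurableSet_eq_fun (hf.comp measurable_snd) measurable_fst)
    rw [ae_map_iff (by fun_prop) hm]
    filter_upwards [measure_eq_zero_iff_ae_notMem.1 ht0] with x hx
    exact ⟨hx, rfl⟩
  rw [← ProbabilityTheory.compProd_map_condDistrib aemeasurable_id] at h1
  filter_upwards [Measure.ae_ae_of_ae_compProd h1] with s hs
  obtain ⟨x, hx, hxs⟩ := hs.exists
  exact ⟨x, not_not.1 fun hn => hx (ht hn), hxs⟩

/-- If two random variables have the same distribution, then they take a common value at points
of given sets of full measure. -/
theorem exists_eq_of_map_eq {α β S : Type*} [MeasurableSpace α] [StandardBorelSpace α]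
    [MeasurableSpace β] [StandardBorelSpace β] [MeasurableSpace S] [StandardBorelSpace S]
    {μ : Measure α} {ν : Measure β} [IsProbabilityMeasure μ] [IsProbabilityMeasure ν]
    {f : α → S} {g : β → S} (hf : Measurable f) (hg : Measurable g) (h : μ.map f = ν.map g)
    {p : α → Prop} {q : β → Prop} (hp : ∀ᵐ x ∂μ, p x) (hq : ∀ᵐ y ∂ν, q y) :
    ∃ x y, p x ∧ q y ∧ f x = g y := by
  have h1 := ae_map_exists_eq hf hp
  rw [h] at h1
  have := Measure.isProbabilityMeasure_map (μ := ν) hg.aemeasurable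
  obtain ⟨s, ⟨x, hx, hxs⟩, y, hy, hys⟩ := (h1.and (ae_map_exists_eq hg hq)).exists
  exact ⟨x, y, hx, hy, hxs.trans hys.symm⟩

theorem List.prod_map_sumElim {ι κ : Type*} (u : ι → ℝ) (v : κ → ℝ) (l : List (ι ⊕ κ)) :
    (l.map (Sum.elim u v)).prod = ((l.filterMap Sum.getLeft?).map u).prod *
      ((l.filterMap Sum.getRight?).map v).prod := by
  induction l with
  | nil => simp
  | cons i l ih =>
    rcases i with i | i
    · rw [List.filterMap_cons_some (by rfl), List.filterMap_cons_none (by rfl)]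
      simp only [List.map_cons, List.prod_cons, ih, Sum.elim_inl, mul_assoc]
    · rw [List.filterMap_cons_none (by rfl), List.filterMap_cons_some (by rfl)]
      simp only [List.map_cons, List.prod_cons, ih, Sum.elim_inr, mul_left_comm]

theorem measurable_list_prod_apply {ι : Type*} (l : List ι) :
    Measurable fun x : ι → ℝ => (l.map x).prod := by
  induction l with
  | nil => simp
  | cons i l ih =>
    simp only [List.map_cons, List.prod_cons]
    exact (measurable_pi_apply i).mul ih

/-! ### Recovering the common factor from the moments -/

namespace Graphon

variable {Ω : Type*} [MeasurableSpace Ω] {π : Measure Ω} [IsProbabilityMeasure π]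

theorem integral_momentKernel {H : Graphon Ω π} (hH : Measurable fun z : Ω × Ω => H.W z.1 z.2)
    (t : Bool × List ℕ × List ℕ) (a : ℕ → Ω) :
    Integrable (fun z : Ω × Ω => H.momentKernel t a z.1 z.2) (π.prod π) ∧
      ∫ z, H.momentKernel t a z.1 z.2 ∂(π.prod π) = H.moment t a := by
  have hi : Integrable (fun z : Ω × Ω => H.momentKernel t a z.1 z.2) (π.prod π) :=
    ((bddMeasurable_momentKernel hH t).comp
      (g := fun z : Ω × Ω => ((a, z.2), z.1)) (by fun_prop)).integrable _
  exact ⟨hi, by rw [integral_prod_symm _ hi, moment]⟩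

theorem exists_anchorMap_bound {H : Graphon Ω π}
    (hH : Measurable fun z : Ω × Ω => H.W z.1 z.2) : ∃ B : ℝ, ∀ a x j, |H.anchorMap a x j| ≤ B :=
  (bddMeasurable_conv hH).bounded.imp fun _ hB a x j => hB (x, a j)

theorem integral_map_anchorMap {H : Graphon Ω π} (hH : Measurable fun z : Ω × Ω => H.W z.1 z.2)
    (a : ℕ → Ω) (l : List ℕ) :
    ∫ x, (l.map x).prod ∂(π.map (H.anchorMap a)) = H.moment (false, l, []) a := by
  rw [integral_map (measurable_anchorMap hH a).aemeasurable (measurable_list_prod_apply l).aestronglyMeasurable]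
  simp [moment, momentKernel]
  rfl

/-- The distribution of the pair of anchor maps under the density `W + C`. -/
noncomputable def anchorLaw (H : Graphon Ω π) (C : ℝ) (a : ℕ → Ω) : Measure (ℕ ⊕ ℕ → ℝ) :=
  ((π.prod π).withDensity fun z => ENNReal.ofReal (H.W z.1 z.2 + C)).map
    fun z => Sum.elim (H.anchorMap a z.1) (H.anchorMap a z.2)

theorem measurable_sumElim_anchorMap {H : Graphon Ω π}
    (hH : Measurable fun z : Ω × Ω => H.W z.1 z.2) (a : ℕ → Ω) :
    Measurable fun z : Ω × Ω => Sum.elim (H.anchorMap a z.1) (H.anchorMap a z.2) := by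
  have h := measurable_anchorMap hH a
  refine measurable_pi_lambda _ fun i => ?_
  rcases i with i | i
  · exact (measurable_pi_apply i).comp (h.comp measurable_fst)
  · exact (measurable_pi_apply i).comp (h.comp measurable_snd)

theorem isFiniteMeasure_anchorLaw {H : Graphon Ω π}
    (hH : Measurable fun z : Ω × Ω => H.W z.1 z.2) (C : ℝ) (a : ℕ → Ω) :
    IsFiniteMeasure (H.anchorLaw C a) := by
  have : IsFiniteMeasure ((π.prod π).withDensity fun z => ENNReal.ofReal (H.W z.1 z.2 + C)) :=
    isFiniteMeasure_withDensity_ofReal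
      (((bddMeasurable_W hH).integrable (π.prod π)).add (integrable_const C)).2
  unfold anchorLaw
  infer_instance

/-- The bound on `W` makes `W + C` a genuine nonnegative density; its two summands give the two
moments. -/
theorem integral_anchorLaw {H : Graphon Ω π} (hH : Measurable fun z : Ω × Ω => H.W z.1 z.2)
    {C : ℝ} (hC : ∀ x y, |H.W x y| ≤ C) (a : ℕ → Ω) (l : List (ℕ ⊕ ℕ)) :
    ∫ x, (l.map x).prod ∂(H.anchorLaw C a) =
      H.moment (true, l.filterMap Sum.getLeft?, l.filterMap Sum.getRight?) a +
        C * H.moment (false, l.filterMap Sum.getLeft?, l.filterMap Sum.getRight?) a := by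
  rw [anchorLaw, integral_map (measurable_sumElim_anchorMap hH a).aemeasurable
    (measurable_list_prod_apply l).aestronglyMeasurable, integral_withDensity_eq_integral_toReal_smul
    (hH.add_const C).ennreal_ofReal (Filter.Eventually.of_forall fun _ => ENNReal.ofReal_lt_top),
    ← (integral_momentKernel hH _ a).2, ← (integral_momentKernel hH _ a).2,
    ← integral_const_mul, ← integral_add (integral_momentKernel hH _ a).1
      ((integral_momentKernel hH _ a).1.const_mul C)]
  refine integral_congr_ae (Filter.Eventually.of_forall fun z => ?_)
  have h0 : 0 ≤ H.W z.1 z.2 + C := by linarith [(abs_le.1 (hC z.1 z.2)).1]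
  simp only [ENNReal.toReal_ofReal h0, List.prod_map_sumElim, momentKernel, smul_eq_mul,
    if_true, Bool.false_eq_true, if_false, one_mul]
  rw [add_mul]
  rfl

/-- This exhibits `U + C`, cut off at `0`, as the density of the anchor law relative to the square
of the law of one anchor map. Uniqueness of densities then pins down `U`. -/
theorem withDensity_eq_map_anchorLaw {H : Graphon Ω π}
    (hH : Measurable fun z : Ω × Ω => H.W z.1 z.2) (C : ℝ) (a : ℕ → Ω)
    {U : (ℕ → ℝ) × (ℕ → ℝ) → ℝ} (hU : Measurable U)
    (h : ∀ᵐ z ∂π.prod π, H.W z.1 z.2 = U (H.anchorMap a z.1, H.anchorMap a z.2)) :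
    ((π.map (H.anchorMap a)).prod (π.map (H.anchorMap a))).withDensity
        (fun p => ENNReal.ofReal (U p + C)) =
      (H.anchorLaw C a).map fun u => (fun j => u (Sum.inl j), fun j => u (Sum.inr j)) := by
  have hφ := measurable_anchorMap hH a
  rw [anchorLaw, Measure.map_map (by fun_prop) (measurable_sumElim_anchorMap hH a)]
  ext s hs
  rw [withDensity_apply _ hs, Measure.map_prod_map _ _ hφ hφ,
    setLIntegral_map hs (by fun_prop) (hφ.prodMap hφ),
    Measure.map_apply (by
      exact (hφ.comp measurable_fst).prodMk (hφ.comp measurable_snd)) hs,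
    withDensity_apply _ (by
      exact ((hφ.comp measurable_fst).prodMk (hφ.comp measurable_snd)) hs)]
  refine setLIntegral_congr_fun_ae ((hφ.prodMap hφ) hs) ?_
  filter_upwards [h] with z hz _
  rw [hz]; rfl

section Equality

variable {Ω' : Type*} [MeasurableSpace Ω'] {π' : Measure Ω'} [IsProbabilityMeasure π']
  {H : Graphon Ω π} {H' : Graphon Ω' π'}

/-- Anchored graphons with the same moments have the same image. -/
theorem exists_common_factor (hH : Measurable fun z : Ω × Ω => H.W z.1 z.2)
    (hH' : Measurable fun z : Ω' × Ω' => H'.W z.1 z.2) {a : ℕ → Ω} {a' : ℕ → Ω'}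
    (h : ∃ U : (ℕ → ℝ) × (ℕ → ℝ) → ℝ, Measurable U ∧
      ∀ᵐ z ∂π.prod π, H.W z.1 z.2 = U (H.anchorMap a z.1, H.anchorMap a z.2))
    (h' : ∃ U : (ℕ → ℝ) × (ℕ → ℝ) → ℝ, Measurable U ∧
      ∀ᵐ z ∂π'.prod π', H'.W z.1 z.2 = U (H'.anchorMap a' z.1, H'.anchorMap a' z.2))
    (hM : ∀ t, H.moment t a = H'.moment t a') :
    π.map (H.anchorMap a) = π'.map (H'.anchorMap a') ∧
    ∃ U : (ℕ → ℝ) × (ℕ → ℝ) → ℝ, Measurable U ∧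
      (∀ᵐ z ∂π.prod π, H.W z.1 z.2 = U (H.anchorMap a z.1, H.anchorMap a z.2)) ∧
      ∀ᵐ z ∂π'.prod π', H'.W z.1 z.2 = U (H'.anchorMap a' z.1, H'.anchorMap a' z.2) := by
  obtain ⟨B, hB⟩ := exists_anchorMap_bound hH
  obtain ⟨B', hB'⟩ := exists_anchorMap_bound hH'
  have hφ := measurable_anchorMap hH a
  have hφ' := measurable_anchorMap hH' a'
  have hset : MeasurableSet {x : ℕ → ℝ | ∀ i, |x i| ≤ max B B'} := by
    simp only [Set.ofPred_forall]
    exact MeasurableSet.iInter fun i => measurableSet_le (by fun_prop) measurable_const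
  have hset' : MeasurableSet {x : ℕ ⊕ ℕ → ℝ | ∀ i, |x i| ≤ max B B'} := by
    simp only [Set.ofPred_forall]
    exact MeasurableSet.iInter fun i => measurableSet_le (by fun_prop) measurable_const
  have hρ : π.map (H.anchorMap a) = π'.map (H'.anchorMap a') := by
    refine Measure.ext_of_forall_integral_list_prod_eq (fun _ => max B B') ?_ ?_ fun l => ?_
    · rw [ae_map_iff hφ.aemeasurable hset]
      exact Filter.Eventually.of_forall fun x i => (hB a x i).trans (le_max_left _ _)
    · rw [ae_map_iff hφ'.aemeasurable hset]
      exact Filter.Eventually.of_forall fun x i => (hB' a' x i).trans (le_max_right _ _)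
    · rw [integral_map_anchorMap hH, integral_map_anchorMap hH', hM]
  obtain ⟨C₁, hC₁⟩ := H.bounded
  obtain ⟨C₂, hC₂⟩ := H'.bounded
  set C := max C₁ C₂
  have hC : ∀ x y, |H.W x y| ≤ C := fun x y => (hC₁ x y).trans (le_max_left _ _)
  have hC' : ∀ x y, |H'.W x y| ≤ C := fun x y => (hC₂ x y).trans (le_max_right _ _)
  have hlaw : H.anchorLaw C a = H'.anchorLaw C a' := by
    have := isFiniteMeasure_anchorLaw hH C a
    have := isFiniteMeasure_anchorLaw hH' C a'
    refine Measure.ext_of_forall_integral_list_prod_eq (fun _ => max B B') ?_ ?_ fun l => ?_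
    · rw [anchorLaw, ae_map_iff (measurable_sumElim_anchorMap hH a).aemeasurable hset']
      exact Filter.Eventually.of_forall fun x i => by
        rcases i with i | i <;> exact (hB a _ i).trans (le_max_left _ _)
    · rw [anchorLaw, ae_map_iff (measurable_sumElim_anchorMap hH' a').aemeasurable hset']
      exact Filter.Eventually.of_forall fun x i => by
        rcases i with i | i <;> exact (hB' a' _ i).trans (le_max_right _ _)
    · rw [integral_anchorLaw hH hC, integral_anchorLaw hH' hC', hM, hM]
  obtain ⟨U, hU, hUW⟩ := h
  obtain ⟨U', hU', hUW'⟩ := h'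
  -- `ENNReal.ofReal` forgets how far `U` drops below `-C`, so the comparison of densities
  -- determines only this truncation.
  refine ⟨hρ, fun p => max (-C) (U p), by fun_prop, ?_, ?_⟩
  · filter_upwards [hUW] with z hz
    rw [← hz, max_eq_right (abs_le.1 (hC _ _)).1]
  · have h1 := withDensity_eq_map_anchorLaw hH C a hU hUW
    have h2 := withDensity_eq_map_anchorLaw hH' C a' hU' hUW'
    rw [hlaw, ← h2, hρ] at h1
    have := Measure.isProbabilityMeasure_map (μ := π') hφ'.aemeasurable
    rw [withDensity_eq_iff_of_sigmaFinite (by fun_prop) (by fun_prop)] at h1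
    have hmp : MeasurePreserving (H'.anchorMap a') π' (π'.map (H'.anchorMap a')) := ⟨hφ', rfl⟩
    filter_upwards [hUW', (hmp.prod hmp).quasiMeasurePreserving.ae h1] with z hz hz'
    have h3 := congrArg ENNReal.toReal hz'
    simp only [Prod.map, ← hz, ENNReal.toReal_ofReal', max_eq_left
      (by linarith [(abs_le.1 (hC' z.1 z.2)).1] : 0 ≤ H'.W z.1 z.2 + C)] at h3
    have h4 : ∀ t : ℝ, max (-C) t + C = max (t + C) 0 := fun t => by
      rw [max_add, neg_add_cancel, max_comm]
    linarith [h4 (U (H'.anchorMap a' z.1, H'.anchorMap a' z.2))]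

/-- Measurable graphons on standard Borel spaces with the same densities are pull-backs of the
same function on the space of sequences. -/
theorem exists_common_factor_of_density_eq [StandardBorelSpace Ω] [StandardBorelSpace Ω']
    (hH : Measurable fun z : Ω × Ω => H.W z.1 z.2)
    (hH' : Measurable fun z : Ω' × Ω' => H'.W z.1 z.2)
    (hd : ∀ (k : ℕ) (F : SimpleGraph (Fin k)), H.density F = H'.density F) :
    ∃ (ρ : Measure (ℕ → ℝ)) (φ : Ω → ℕ → ℝ) (φ' : Ω' → ℕ → ℝ) (U : (ℕ → ℝ) × (ℕ → ℝ) → ℝ),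
      MeasurePreserving φ π ρ ∧ MeasurePreserving φ' π' ρ ∧ Measurable U ∧
      (∀ᵐ z ∂π.prod π, H.W z.1 z.2 = U (φ z.1, φ z.2)) ∧
      ∀ᵐ z ∂π'.prod π', H'.W z.1 z.2 = U (φ' z.1, φ' z.2) := by
  choose B hB using fun t => (bddMeasurable_moment hH t).bounded
  choose B' hB' using fun t => (bddMeasurable_moment hH' t).bounded
  have hm : Measurable fun a t => H.moment t a :=
    measurable_pi_lambda _ fun t => (bddMeasurable_moment hH t).measurable
  have hm' : Measurable fun a t => H'.moment t a :=
    measurable_pi_lambda _ fun t => (bddMeasurable_moment hH' t).measurable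
  have hset : MeasurableSet {x : Bool × List ℕ × List ℕ → ℝ | ∀ t, |x t| ≤ max (B t) (B' t)} := by
    simp only [Set.ofPred_forall]
    exact MeasurableSet.iInter fun i => measurableSet_le (by fun_prop) measurable_const
  -- The index set of the moments is countable, so the whole family is one random point of a
  -- standard Borel space, with law determined by its joint moments.
  have hlaw : (Measure.infinitePi fun _ : ℕ => π).map (fun a t => H.moment t a) =
      (Measure.infinitePi fun _ : ℕ => π').map (fun a t => H'.moment t a) := by
    refine Measure.ext_of_forall_integral_list_prod_eq (fun t => max (B t) (B' t)) ?_ ?_ fun l => ?_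
    · rw [ae_map_iff hm.aemeasurable hset]
      exact Filter.Eventually.of_forall fun a t => (hB t a).trans (le_max_left _ _)
    · rw [ae_map_iff hm'.aemeasurable hset]
      exact Filter.Eventually.of_forall fun a t => (hB' t a).trans (le_max_right _ _)
    · rw [integral_map hm.aemeasurable (measurable_list_prod_apply l).aestronglyMeasurable,
        integral_map hm'.aemeasurable (measurable_list_prod_apply l).aestronglyMeasurable]
      exact integral_moments_eq hH hH' hd l
  obtain ⟨a, a', ha, ha', haa⟩ := exists_eq_of_map_eq hm hm' hlaw
    (ae_exists_factor_anchorMap hH) (ae_exists_factor_anchorMap hH')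
  obtain ⟨hρ, U, hU, h1, h2⟩ := exists_common_factor hH hH' ha ha' (congrFun haa)
  exact ⟨_, _, _, U, ⟨measurable_anchorMap hH a, rfl⟩, ⟨measurable_anchorMap hH' a', hρ.symm⟩,
    hU, h1, h2⟩

end Equality

end Graphon

/-! ### Equal densities give weak isomorphism -/

namespace Graphon

variable {Ω Ω' : Type*} [MeasurableSpace Ω] [MeasurableSpace Ω']
  {π : Measure Ω} [IsProbabilityMeasure π] {π' : Measure Ω'} [IsProbabilityMeasure π']

/-- Graphons with the same densities have weak isomorphisms into a common graphon on the space of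
sequences. -/
theorem exists_isWeakIso_of_density_eq {H : Graphon Ω π} {H' : Graphon Ω' π'}
    (hd : ∀ (k : ℕ) (F : SimpleGraph (Fin k)), H.density F = H'.density F) {a b : ℝ}
    (hab : a ≤ b) (hH : ∀ x y, H.W x y ∈ Set.Icc a b) :
    ∃ (ρ : Measure (ℕ → ℝ)) (_ : IsProbabilityMeasure ρ) (G : Graphon (ℕ → ℝ) ρ)
      (φ : Ω → ℕ → ℝ) (φ' : Ω' → ℕ → ℝ), Measurable (fun z : _ × _ => G.W z.1 z.2) ∧
      (∀ x y, G.W x y ∈ Set.Icc a b) ∧ H.IsWeakIso G φ ∧ H'.IsWeakIso G φ' := by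
  obtain ⟨ρ₀, _, G₀, ψ, hG₀, hψ⟩ := H.exists_isWeakIso_standardBorel
  obtain ⟨ρ₀', _, G₀', ψ', hG₀', hψ'⟩ := H'.exists_isWeakIso_standardBorel
  obtain ⟨ρ, φ, φ', U, hφ, hφ', hU, h1, h2⟩ := exists_common_factor_of_density_eq hG₀ hG₀'
    fun k F => by rw [← hψ.density_eq, ← hψ'.density_eq, hd]
  have hρ : IsProbabilityMeasure ρ := hφ.nullMeasurePreserving.isProbabilityMeasure
  rw [isWeakIso_iff] at hψ hψ'
  -- Only the bounds of `H` enter. By `hGU` the correction of `U` is null for `ρ.prod ρ`, so `G`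
  -- serves `H'` as well.
  obtain ⟨G, hG, hw, hb, hGU⟩ := H.exists_isWeakIso_of_ae_eq (ρ := ρ)
    (hφ.nullMeasurePreserving.comp hψ.1) hU (by
      filter_upwards [hψ.2, hψ.1.prodMap.ae h1] with z h3 h4
      rw [h3]; exact h4) hab hH
  have hc := hφ'.nullMeasurePreserving.comp hψ'.1
  refine ⟨ρ, hρ, G, φ ∘ ψ, φ' ∘ ψ', hG, hb, hw, isWeakIso_iff.2 ⟨hc, ?_⟩⟩
  filter_upwards [hψ'.2, hψ'.1.prodMap.ae h2, hc.prodMap.ae hGU] with z h3 h4 h5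
  rw [h3]
  exact h4.trans h5.symm

theorem density_eq_of_weaklyIsomorphic {H : Graphon Ω π} {H' : Graphon Ω' π'}
    (h : H.WeaklyIsomorphic H') (k : ℕ) (F : SimpleGraph (Fin k)) :
    H.density F = H'.density F := by
  obtain ⟨Γ, _, ρ, _, G, φ, ψ, h1, h2⟩ := h
  rw [h1.density_eq, h2.density_eq]

theorem exists_mem_Icc (H : Graphon Ω π) : ∃ a b : ℝ, a ≤ b ∧ ∀ x y, H.W x y ∈ Set.Icc a b := by
  obtain ⟨C, hC⟩ := H.bounded
  obtain ⟨x⟩ := nonempty_of_isProbabilityMeasure π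
  exact ⟨-C, C, neg_le_self ((abs_nonneg _).trans (hC x x)), fun x y => abs_le.1 (hC x y)⟩

/-- A `ULift` copy of the sequence space puts the common graphon in the prescribed universe `w`. -/
theorem weaklyIsomorphic_of_density_eq {H : Graphon Ω π} {H' : Graphon Ω' π'}
    (hd : ∀ (k : ℕ) (F : SimpleGraph (Fin k)), H.density F = H'.density F) :
    WeaklyIsomorphic.{_, _, w} H H' := by
  obtain ⟨a, b, hab, hH⟩ := H.exists_mem_Icc
  obtain ⟨ρ, _, G, φ, φ', hG, hb, h1, h2⟩ := exists_isWeakIso_of_density_eq hd hab hH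
  have hup : Measurable (ULift.up.{w} : (ℕ → ℝ) → ULift.{w} (ℕ → ℝ)) := measurable_up
  have hp : IsProbabilityMeasure (ρ.map (ULift.up.{w} : (ℕ → ℝ) → ULift.{w} (ℕ → ℝ))) :=
    Measure.isProbabilityMeasure_map hup.aemeasurable
  obtain ⟨G', -, hw, -⟩ := G.exists_isWeakIso_of_ae_eq
    (MeasurePreserving.nullMeasurePreserving (⟨hup, rfl⟩ : MeasurePreserving _ ρ _))
    (g := fun z => G.W z.1.down z.2.down)
    (hG.comp ((measurable_down.comp measurable_fst).prodMk (measurable_down.comp measurable_snd)))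
    (Filter.Eventually.of_forall fun z => rfl) hab hb
  exact ⟨_, _, _, hp, G', _, _, hw.comp h1, hw.comp h2⟩

end Graphon

/-! ### Almost twin-free graphons on Lebesgue spaces -/

section IsoModZero

variable {α β : Type*} [MeasurableSpace α] [MeasurableSpace β] {μ : Measure α} {ν : Measure β}

/-- Measure preserving maps that are inverse to each other almost everywhere are isomorphisms
mod 0. -/
theorem isIsoModZero_of_ae_inverse {φ : α → β} {ψ : β → α} (hφ : MeasurePreserving φ μ ν)
    (hψ : MeasurePreserving ψ ν μ) (h1 : ∀ᵐ x ∂μ, ψ (φ x) = x) (h2 : ∀ᵐ y ∂ν, φ (ψ y) = y) :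
    IsIsoModZero φ μ ν := by
  obtain ⟨t, ht, htm, ht0⟩ := exists_measurable_superset_of_null h1
  obtain ⟨t', ht', htm', ht0'⟩ := exists_measurable_superset_of_null h2
  have e1 : ∀ x ∉ t, ψ (φ x) = x := fun x hx => not_not.1 fun hn => hx (ht hn)
  have e2 : ∀ y ∉ t', φ (ψ y) = y := fun y hy => not_not.1 fun hn => hy (ht' hn)
  have hN : MeasurableSet (t ∪ φ ⁻¹' t') := htm.union (hφ.measurable htm')
  have hN' : MeasurableSet (t' ∪ ψ ⁻¹' t) := htm'.union (hψ.measurable htm)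
  have hN0 : μ (t ∪ φ ⁻¹' t') = 0 :=
    measure_union_null ht0 (by rw [hφ.measure_preimage htm'.nullMeasurableSet, ht0'])
  have hN0' : ν (t' ∪ ψ ⁻¹' t) = 0 :=
    measure_union_null ht0' (by rw [hψ.measure_preimage htm.nullMeasurableSet, ht0])
  have m1 : ∀ x ∈ (t ∪ φ ⁻¹' t')ᶜ, φ x ∈ (t' ∪ ψ ⁻¹' t)ᶜ := fun x hx => by
    simp only [Set.mem_compl_iff, Set.mem_union, Set.mem_preimage, not_or] at hx ⊢
    rw [e1 x hx.1]
    exact hx.symm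
  have m2 : ∀ y ∈ (t' ∪ ψ ⁻¹' t)ᶜ, ψ y ∈ (t ∪ φ ⁻¹' t')ᶜ := fun y hy => by
    simp only [Set.mem_compl_iff, Set.mem_union, Set.mem_preimage, not_or] at hy ⊢
    rw [e2 y hy.1]
    exact hy.symm
  let e : ↥((t ∪ φ ⁻¹' t')ᶜ) ≃ᵐ ↥((t' ∪ ψ ⁻¹' t)ᶜ) :=
    { toFun := fun x => ⟨φ x, m1 x x.2⟩
      invFun := fun y => ⟨ψ y, m2 y y.2⟩
      left_inv := fun x => Subtype.ext (e1 x fun h => x.2 (Or.inl h))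
      right_inv := fun y => Subtype.ext (e2 y fun h => y.2 (Or.inl h))
      measurable_toFun := (hφ.measurable.comp measurable_subtype_coe).subtype_mk
      measurable_invFun := (hψ.measurable.comp measurable_subtype_coe).subtype_mk }
  refine ⟨hφ, _, _, hN, hN0, hN', hN0', e, fun x => rfl, e.measurable, ?_⟩
  ext s hs
  rw [Measure.map_apply e.measurable hs, comap_subtype_coe_apply hN.compl,
    comap_subtype_coe_apply hN'.compl]
  have hB : MeasurableSet (Subtype.val '' s) := hN'.compl.subtype_image hs
  rw [← hφ.measure_preimage hB.nullMeasurableSet]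
  have himg : Subtype.val '' (e ⁻¹' s) = φ ⁻¹' (Subtype.val '' s) ∩ (t ∪ φ ⁻¹' t')ᶜ := by
    ext x
    constructor
    · rintro ⟨x, hx, rfl⟩
      exact ⟨⟨e x, hx, rfl⟩, x.2⟩
    · rintro ⟨⟨y, hy, hyx⟩, hx⟩
      refine ⟨⟨x, hx⟩, ?_, rfl⟩
      rw [Set.mem_preimage]
      convert hy
      exact Subtype.ext hyx.symm
  rw [himg]
  exact measure_inter_conull (by rwa [compl_compl])

theorem NullMeasurePreserving.measurePreserving [μ.IsComplete] {f : α → β}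
    (hf : NullMeasurePreserving f μ ν) : MeasurePreserving f μ ν := by
  have hm : Measurable f := hf.nullMeasurable.measurable_of_complete
  refine ⟨hm, Measure.ext fun s hs => ?_⟩
  rw [Measure.map_apply hm hs, hf.measure_preimage s hs]

/-- The fixed-point set of a measurable representative of `r` is measurable, so its measure can be
computed on the source of `f`. This turns almost everywhere left inverses into two-sided ones. -/
theorem NullMeasurePreserving.ae_eq_id {K : Type*} [MeasurableSpace K] [StandardBorelSpace K]
    {ρ : Measure K} {f : α → K} (hf : NullMeasurePreserving f μ ρ) {r : K → K}
    (hr : NullMeasurePreserving r ρ ρ) (h : ∀ᵐ x ∂μ, r (f x) = f x) : ∀ᵐ y ∂ρ, r y = y := by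
  obtain ⟨q, hq, hqe⟩ := hr.exists_measurePreserving
  have h1 : MeasurableSet {y | q y = y} := measurableSet_eq_fun hq.measurable measurable_id
  have h2 : ∀ᵐ y ∂ρ, q y = y := by
    rw [ae_iff]
    refine (hf.measure_preimage _ h1.compl).symm.trans ?_
    change ∀ᵐ x ∂μ, q (f x) = f x
    filter_upwards [h, hf.ae hqe] with x h3 h4
    rw [← h4, h3]
  filter_upwards [h2, hqe] with y h3 h4
  rw [h4, h3]

end IsoModZero

/-- The model of a Lebesgue space, an interval plus atoms, is such a sum. The point to check is that
the Borel sets of the sum topology form the sum σ-algebra. -/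
instance StandardBorelSpace.sum {α β : Type*} [MeasurableSpace α] [StandardBorelSpace α]
    [MeasurableSpace β] [StandardBorelSpace β] : StandardBorelSpace (α ⊕ β) := by
  let := upgradeStandardBorel α
  let := upgradeStandardBorel β
  have hb : BorelSpace (α ⊕ β) := by
    refine ⟨le_antisymm (fun s hs => ?_) (MeasurableSpace.generateFrom_le fun s hs => ?_)⟩
    · rw [measurableSet_sum_iff] at hs
      have h1 : @MeasurableSet _ (borel (α ⊕ β)) (Sum.inl '' (Sum.inl ⁻¹' s)) := by
        let : MeasurableSpace (α ⊕ β) := borel _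
        have : BorelSpace (α ⊕ β) := ⟨rfl⟩
        exact Topology.IsOpenEmbedding.inl.measurableEmbedding.measurableSet_image.2 hs.1
      have h2 : @MeasurableSet _ (borel (α ⊕ β)) (Sum.inr '' (Sum.inr ⁻¹' s)) := by
        let : MeasurableSpace (α ⊕ β) := borel _
        have : BorelSpace (α ⊕ β) := ⟨rfl⟩
        exact Topology.IsOpenEmbedding.inr.measurableEmbedding.measurableSet_image.2 hs.2
      rw [← Set.image_preimage_inl_union_image_preimage_inr s]
      exact MeasurableSet.union h1 h2
    · rw [measurableSet_sum_iff]
      have hs' : IsOpen s := hs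
      exact ⟨(hs'.preimage continuous_inl).measurableSet,
        (hs'.preimage continuous_inr).measurableSet⟩
  exact ⟨⟨inferInstance, hb, inferInstance⟩⟩

/-- A measurable map of standard Borel spaces that is injective off a measurable null set has
a measurable left inverse off this set. -/
theorem Measurable.exists_leftInverse_of_injOn {α β : Type*} [MeasurableSpace α]
    [StandardBorelSpace α] [Nonempty α] [MeasurableSpace β]
    [MeasurableSpace.CountablySeparated β] {f : α → β} (hf : Measurable f) {t : Set α}
    (ht : MeasurableSet t) (hinj : Set.InjOn f tᶜ) :
    ∃ g : β → α, Measurable g ∧ ∀ x ∉ t, g (f x) = x := by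
  have := ht.compl.standardBorel
  -- By Lusin–Souslin an injective measurable map on a standard Borel space is a measurable
  -- embedding.
  obtain ⟨g, hg, hgf⟩ := ((hf.comp measurable_subtype_coe).measurableEmbedding
    (Set.injOn_iff_injective.1 hinj)).exists_measurable_extend
    (measurable_subtype_coe (p := (· ∈ tᶜ))) fun _ => inferInstance
  exact ⟨g, hg, fun x hx => congrFun hgf ⟨x, hx⟩⟩

section LebesgueSpace

variable {Ω Ω' : Type*} [MeasurableSpace Ω] [MeasurableSpace Ω']
  {π : Measure Ω} [IsProbabilityMeasure π] {π' : Measure Ω'} [IsProbabilityMeasure π']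

/-- An isomorphism mod 0 onto a completed space has an inverse off null sets. -/
theorem IsIsoModZero.exists_inverse {J : Type*} [MeasurableSpace J] {m : Measure J}
    {φ : Ω → NullMeasurableSpace J m} (h : IsIsoModZero φ π m.completion) :
    ∃ (θ : Ω → J) (ψ : J → Ω), NullMeasurePreserving θ π m ∧ NullMeasurePreserving ψ m π ∧
      (∀ᵐ x ∂π, ψ (θ x) = x) ∧ ∃ N, m N = 0 ∧ Set.InjOn ψ Nᶜ := by
  classical
  obtain ⟨hφ, N, N', -, hN0, hN', hN0', e, he, -⟩ := h
  obtain ⟨x₀⟩ := nonempty_of_isProbabilityMeasure π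
  have hθ : NullMeasurePreserving (β := J) φ π m :=
    ⟨fun s hs => (hφ.measurable (show NullMeasurableSet s m from
      hs.nullMeasurableSet)).nullMeasurableSet, fun s hs => by
      have hs' : @MeasurableSet (NullMeasurableSpace J m) _ s := hs.nullMeasurableSet
      exact hφ.measure_preimage hs'.nullMeasurableSet⟩
  let ψ : J → Ω := fun y => if h : y ∈ N'ᶜ then e.symm ⟨y, h⟩ else x₀
  have hψe : ∀ y : ↥(N'ᶜ), ψ (y : NullMeasurableSpace J m) = e.symm y :=
    fun y => dif_pos y.2
  have hψθ : ∀ᵐ x ∂π, ψ (φ x) = x := by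
    filter_upwards [measure_eq_zero_iff_ae_notMem.1 hN0] with x hx
    rw [← he ⟨x, hx⟩, hψe, e.symm_apply_apply]
  have hψm : ∀ s, MeasurableSet s → NullMeasurableSet (ψ ⁻¹' s) m := fun s hs => by
    have h1 : @MeasurableSet (NullMeasurableSpace J m) _
        (Subtype.val '' (e.symm ⁻¹' (Subtype.val ⁻¹' s))) :=
      hN'.compl.subtype_image (e.symm.measurable (measurable_subtype_coe hs))
    refine NullMeasurableSet.congr (s := (Subtype.val '' (e.symm ⁻¹' (Subtype.val ⁻¹' s)))) h1 ?_
    have h0 : ∀ᵐ y ∂m, y ∉ N' := measure_eq_zero_iff_ae_notMem.1 hN0'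
    filter_upwards [h0] with y hy
    refine propext ⟨?_, fun h => ?_⟩
    · rintro ⟨y, hy', rfl⟩
      change ψ (y : NullMeasurableSpace J m) ∈ s
      rw [hψe]
      exact hy'
    · refine ⟨⟨y, hy⟩, ?_, rfl⟩
      have h' : ψ y ∈ s := h
      rwa [hψe ⟨y, hy⟩] at h'
  refine ⟨φ, ψ, hθ, ⟨fun s hs => hψm s hs, fun s hs => ?_⟩, hψθ, N', hN0',
    fun y hy z hz hyz => ?_⟩
  · rw [← (hθ.measure_preimage₀ (hψm s hs)).2]
    refine measure_congr ?_
    filter_upwards [hψθ] with x hx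
    exact congrArg (· ∈ s) hx
  · rw [hψe ⟨y, hy⟩, hψe ⟨z, hz⟩] at hyz
    exact congrArg Subtype.val (e.symm.injective (Subtype.ext hyz))

/-- A measure preserving map from a Lebesgue space to a standard Borel space that is injective
off a null set has a measurable left inverse. -/
theorem IsLebesgueSpace.exists_ae_leftInverse (h : IsLebesgueSpace π) {K : Type*}
    [MeasurableSpace K] [StandardBorelSpace K] {ρ : Measure K} {f : Ω → K}
    (hf : NullMeasurePreserving f π ρ) {N : Set Ω} (hN : π N = 0) (hinj : Set.InjOn f Nᶜ) :
    ∃ g : K → Ω, NullMeasurePreserving g ρ π ∧ ∀ᵐ x ∂π, g (f x) = x := by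
  obtain ⟨-, a, b, A, p, -, -, φ, hφ⟩ := h
  -- Only the standard Borel structure of the model matters. Transported there, `f` has a measurable
  -- representative `k`, injective off a null set; a left inverse of `k` is carried back by `ψ`.
  generalize intervalWithAtoms a b A p = m at φ hφ
  obtain ⟨θ, ψ, hθ, hψ, hψθ, M, hM, hψinj⟩ := hφ.exists_inverse
  have := (nonempty_of_isProbabilityMeasure π).map θ
  obtain ⟨k, hk, hke⟩ := (hf.comp hψ).exists_measurePreserving
  have hbad : ∀ᵐ i ∂m, i ∉ M ∧ ψ i ∉ N ∧ (f ∘ ψ) i = k i := by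
    filter_upwards [measure_eq_zero_iff_ae_notMem.1 hM,
      hψ.ae (measure_eq_zero_iff_ae_notMem.1 hN), hke] with i h1 h2 h3 using ⟨h1, h2, h3⟩
  obtain ⟨t, ht, htm, ht0⟩ := exists_measurable_superset_of_null hbad
  have hgood : ∀ i ∉ t, i ∉ M ∧ ψ i ∉ N ∧ (f ∘ ψ) i = k i := fun i hi =>
    not_not.1 fun hn => hi (ht hn)
  have hkinj : Set.InjOn k tᶜ := fun i hi j hj hij => by
    obtain ⟨h1, h2, h3⟩ := hgood i hi
    obtain ⟨h1', h2', h3'⟩ := hgood j hj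
    exact hψinj h1 h1' (hinj h2 h2' (h3.trans (hij.trans h3'.symm)))
  obtain ⟨g₀, hg₀, hg₀k⟩ := hk.measurable.exists_leftInverse_of_injOn htm hkinj
  have hleft : ∀ᵐ i ∂m, g₀ (k i) = i := by
    filter_upwards [measure_eq_zero_iff_ae_notMem.1 ht0] with i hi using hg₀k i hi
  have hg₀mp : NullMeasurePreserving g₀ ρ m := by
    refine ⟨hg₀.nullMeasurable, fun s hs => ?_⟩
    rw [← hk.measure_preimage (hg₀ hs).nullMeasurableSet]
    refine measure_congr ?_
    filter_upwards [hleft] with i hi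
    exact congrArg (· ∈ s) hi
  refine ⟨ψ ∘ g₀, hψ.comp hg₀mp, ?_⟩
  filter_upwards [hψθ, hθ.ae hleft, hθ.ae hke] with x h1 h2 h3
  simp only [Function.comp_apply] at h3 ⊢
  rw [← h1, h3, h2]

/-- Off a null set, a weak isomorphism only identifies twins. -/
theorem Graphon.IsWeakIso.exists_injOn {H : Graphon Ω π} {G : Graphon Ω' π'} {φ : Ω → Ω'}
    (h : H.IsWeakIso G φ) (hH : H.AlmostTwinFree) : ∃ N, π N = 0 ∧ Set.InjOn φ Nᶜ := by
  obtain ⟨N, hN, htw⟩ := hH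
  have h1 : ∀ᵐ x ∂π, ∀ᵐ y ∂π, H.W x y = G.W (φ x) (φ y) := Measure.ae_ae_of_ae_prod h.2
  refine ⟨N ∪ {x | ¬ ∀ᵐ y ∂π, H.W x y = G.W (φ x) (φ y)}, measure_union_null hN h1,
    fun x hx y hy hxy => ?_⟩
  simp only [Set.mem_compl_iff, Set.mem_union, Set.mem_ofPred_eq, not_or, not_not] at hx hy
  by_contra hne
  refine htw x hx.1 y hy.1 hne ?_
  filter_upwards [hx.2, hy.2] with z h2 h3
  rw [h2, h3, hxy]

/-- The isomorphism goes through the common graphon: `f` out of `Ω`, then the inverse `g'` of `f'`.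
Completeness of the spaces upgrades null measurability to measurability. -/
theorem Graphon.isomorphicModZero_of_density_eq {H : Graphon Ω π} {H' : Graphon Ω' π'}
    (hπ : IsLebesgueSpace π) (hπ' : IsLebesgueSpace π') (hH : H.AlmostTwinFree)
    (hH' : H'.AlmostTwinFree)
    (hd : ∀ (k : ℕ) (F : SimpleGraph (Fin k)), H.density F = H'.density F) :
    H.IsomorphicModZero H' := by
  obtain ⟨a, b, hab, hHb⟩ := H.exists_mem_Icc
  obtain ⟨ρ, _, G, f, f', -, -, h1, h2⟩ := exists_isWeakIso_of_density_eq hd hab hHb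
  obtain ⟨N, hN, hinj⟩ := h1.exists_injOn hH
  obtain ⟨N', hN', hinj'⟩ := h2.exists_injOn hH'
  rw [isWeakIso_iff] at h1 h2
  obtain ⟨g, hg, hgf⟩ := hπ.exists_ae_leftInverse h1.1 hN hinj
  obtain ⟨g', hg', hgf'⟩ := hπ'.exists_ae_leftInverse h2.1 hN' hinj'
  have hfg : ∀ᵐ y ∂ρ, f (g y) = y := h1.1.ae_eq_id (h1.1.comp hg) (by
    filter_upwards [hgf] with x hx
    exact congrArg _ hx)
  have hfg' : ∀ᵐ y ∂ρ, f' (g' y) = y := h2.1.ae_eq_id (h2.1.comp hg') (by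
    filter_upwards [hgf'] with x hx
    exact congrArg _ hx)
  have := hπ.1
  have := hπ'.1
  refine ⟨g' ∘ f, isIsoModZero_of_ae_inverse (ψ := g ∘ f')
    (hg'.comp h1.1).measurePreserving (hg.comp h2.1).measurePreserving ?_ ?_, ?_⟩
  · filter_upwards [hgf, h1.1.ae hfg'] with x h3 h4
    simp only [Function.comp_apply, h4, h3]
  · filter_upwards [hgf', h2.1.ae hfg] with x h3 h4
    simp only [Function.comp_apply, h4, h3]
  · have h5 : ∀ᵐ x ∂π, f' (g' (f x)) = f x := h1.1.ae hfg'
    filter_upwards [h1.2, (hg'.comp h1.1).prodMap.ae h2.2,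
      Measure.quasiMeasurePreserving_fst.ae h5, Measure.quasiMeasurePreserving_snd.ae h5]
      with z h3 h4 h5 h6
    simp only [Prod.map, Function.comp_apply, h5, h6] at h4
    simp only [Function.comp_apply, h4, h3]

theorem Graphon.IsomorphicModZero.density_eq {H : Graphon Ω π} {H' : Graphon Ω' π'}
    (h : H.IsomorphicModZero H') (k : ℕ) (F : SimpleGraph (Fin k)) :
    H.density F = H'.density F := by
  obtain ⟨φ, hφ, hW⟩ := h
  refine IsWeakIso.density_eq (φ := φ) (isWeakIso_iff.2 ⟨hφ.1.nullMeasurePreserving, ?_⟩) F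
  filter_upwards [hW] with z hz using hz.symm

end LebesgueSpace

/-! ### Atomless spaces and the unit interval -/

section UnitInterval

/-- The distribution function of an atomless probability measure is continuous from the left. -/
theorem tendsto_cdf_nhdsLT (ν : Measure ℝ) [IsProbabilityMeasure ν] (hν : ∀ x, ν {x} = 0)
    (x : ℝ) : Filter.Tendsto (ProbabilityTheory.cdf ν) (nhdsWithin x (Set.Iio x))
      (nhds (ProbabilityTheory.cdf ν x)) := by
  have hm := ProbabilityTheory.monotone_cdf ν
  have h := (ProbabilityTheory.cdf ν).measure_singleton x
  rw [ProbabilityTheory.measure_cdf, hν, eq_comm, ENNReal.ofReal_eq_zero] at h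
  have h2 : Function.leftLim (ProbabilityTheory.cdf ν) x = ProbabilityTheory.cdf ν x :=
    le_antisymm (hm.leftLim_le le_rfl) (by linarith)
  rw [← h2]
  exact hm.tendsto_leftLim x

/-- The distribution function of an atomless probability measure on the line, as a map to the unit
interval. -/
noncomputable def unitCDF (ν : Measure ℝ) (t : ℝ) : unitInterval :=
  ⟨ProbabilityTheory.cdf ν t, ProbabilityTheory.cdf_nonneg ν t, ProbabilityTheory.cdf_le_one ν t⟩

theorem monotone_unitCDF (ν : Measure ℝ) : Monotone (unitCDF ν) :=
  fun _ _ h => ProbabilityTheory.monotone_cdf ν h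

/-- For `s < 1` a nonempty sublevel set of the distribution function is a half-line ending at its
supremum `x`; left continuity gives `F x ≤ s` and right continuity excludes `F x < s`. -/
theorem measurePreserving_unitCDF (ν : Measure ℝ) [IsProbabilityMeasure ν]
    (hν : ∀ x, ν {x} = 0) : MeasurePreserving (unitCDF ν) ν volume := by
  have hm : Measurable (unitCDF ν) := (monotone_unitCDF ν).measurable
  refine ⟨hm, ?_⟩
  have := Measure.isProbabilityMeasure_map (μ := ν) hm.aemeasurable
  refine Measure.ext_of_Iic _ _ fun s => ?_
  rw [Measure.map_apply hm measurableSet_Iic, unitInterval.volume_Iic]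
  set F := ProbabilityTheory.cdf ν
  have hS : unitCDF ν ⁻¹' Set.Iic s = {t | F t ≤ s} := rfl
  rw [hS]
  rcases eq_or_lt_of_le s.2.2 with h1 | h1
  · rw [h1]
    have : {t | F t ≤ 1} = Set.univ := Set.eq_univ_of_forall fun t =>
      ProbabilityTheory.cdf_le_one ν t
    simp [this]
  obtain ⟨T, hT⟩ := ((ProbabilityTheory.tendsto_cdf_atTop ν).eventually (lt_mem_nhds h1)).exists
  have hbdd : BddAbove {t | F t ≤ s} := ⟨T, fun t ht => le_of_not_gt fun htT =>
    (hT.trans_le (F.mono htT.le)).not_ge ht⟩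
  rcases Set.eq_empty_or_nonempty {t | F t ≤ s} with he | hne
  · rw [he, measure_empty]
    rcases eq_or_lt_of_le s.2.1 with h0 | h0
    · rw [← h0, ENNReal.ofReal_zero]
    · obtain ⟨t, ht⟩ := ((ProbabilityTheory.tendsto_cdf_atBot ν).eventually (gt_mem_nhds h0)).exists
      exact absurd (he ▸ (show t ∈ {t | F t ≤ s} from ht.le)) (Set.notMem_empty t)
  · set x := sSup {t | F t ≤ s}
    have hx : F x ≤ s := by
      refine le_of_tendsto (tendsto_cdf_nhdsLT ν hν x) ?_
      filter_upwards [self_mem_nhdsWithin] with t ht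
      obtain ⟨u, hu, htu⟩ := exists_lt_of_lt_csSup hne ht
      exact (F.mono htu.le).trans hu
    have hxs : F x = s := by
      refine hx.antisymm (le_of_not_gt fun hlt => ?_)
      have h2 : ∀ᶠ t in nhdsWithin x (Set.Ioi x), F t < s :=
        ((F.right_continuous x).tendsto.mono_left
          (nhdsWithin_mono x Set.Ioi_subset_Ici_self)).eventually_lt_const hlt
      obtain ⟨t, ht, hxt⟩ := (h2.and self_mem_nhdsWithin).exists
      exact (le_csSup hbdd (show t ∈ {t | F t ≤ s} from ht.le)).not_gt hxt
    have : {t | F t ≤ s} = Set.Iic x := by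
      ext t
      exact ⟨fun h => le_csSup hbdd h, fun h => (F.mono h).trans hx⟩
    rw [this, ← ProbabilityTheory.ofReal_cdf ν x]
    exact congrArg _ hxs

/-- An atomless probability measure on a standard Borel space is isomorphic to Lebesgue measure on
the unit interval. -/
theorem exists_measurePreserving_unitInterval {α : Type*} [MeasurableSpace α]
    [StandardBorelSpace α] (ν : Measure α) [IsProbabilityMeasure ν] (hν : ∀ x, ν {x} = 0) :
    ∃ (F : α → unitInterval) (Q : unitInterval → α), MeasurePreserving F ν volume ∧
      Measurable Q ∧ ∀ᵐ x ∂ν, Q (F x) = x := by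
  obtain ⟨e, he⟩ := exists_measurableEmbedding_real α
  have := nonempty_of_isProbabilityMeasure ν
  have hp := Measure.isProbabilityMeasure_map (μ := ν) he.measurable.aemeasurable
  have hν' : ∀ t, (ν.map e) {t} = 0 := fun t => by
    rw [Measure.map_apply he.measurable (measurableSet_singleton t)]
    rcases Set.eq_empty_or_nonempty (e ⁻¹' {t}) with h | ⟨x, hx⟩
    · rw [h, measure_empty]
    · refine measure_mono_null (fun y hy => ?_) (hν x)
      exact he.injective (Eq.trans hy (Eq.symm hx))
  have hF := measurePreserving_unitCDF (ν.map e) hν'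
  have hFe : MeasurePreserving (unitCDF (ν.map e) ∘ e) ν volume :=
    hF.comp ⟨he.measurable, rfl⟩
  -- Injectivity fails only where the distribution function is constant on an interval. The interval
  -- contains a rational, so the common value lies in the countable set `B`, whose preimage is null.
  set B := Set.range fun q : ℚ => unitCDF (ν.map e) q
  have hB : B.Countable := Set.countable_range _
  have hBm : MeasurableSet ((unitCDF (ν.map e) ∘ e) ⁻¹' B) := hFe.measurable hB.measurableSet
  have hinj : Set.InjOn (unitCDF (ν.map e) ∘ e) ((unitCDF (ν.map e) ∘ e) ⁻¹' B)ᶜ := by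
    have key : ∀ x y, x ∉ (unitCDF (ν.map e) ∘ e) ⁻¹' B →
        unitCDF (ν.map e) (e x) = unitCDF (ν.map e) (e y) → ¬ e x < e y := by
      intro x y hx hxy hlt
      obtain ⟨q, hq1, hq2⟩ := exists_rat_btwn hlt
      exact hx ⟨q, le_antisymm ((monotone_unitCDF _ hq2.le).trans hxy.ge)
        (monotone_unitCDF _ hq1.le)⟩
    intro x hx y hy hxy
    exact he.injective (le_antisymm (le_of_not_gt (key y x hy hxy.symm))
      (le_of_not_gt (key x y hx hxy)))
  obtain ⟨Q, hQ, hQF⟩ := hFe.measurable.exists_leftInverse_of_injOn hBm hinj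
  refine ⟨_, Q, hFe, hQ, ?_⟩
  have h0 : ν ((unitCDF (ν.map e) ∘ e) ⁻¹' B) = 0 := by
    rw [hFe.measure_preimage hB.measurableSet.nullMeasurableSet]
    exact hB.measure_zero _
  filter_upwards [measure_eq_zero_iff_ae_notMem.1 h0] with x hx using hQF x hx

/-- The measure on `K × [0, 1]` obtained from `ρ` by spreading each atom over the unit
interval. -/
noncomputable def spreadAtoms {K : Type*} [MeasurableSpace K] (ρ : Measure K) :
    Measure (K × unitInterval) :=
  (ρ.restrict {k | ρ {k} = 0}).prod (Measure.dirac 0) +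
    (ρ.restrict {k | ρ {k} = 0}ᶜ).prod volume

variable {K : Type*} [MeasurableSpace K] [StandardBorelSpace K] (ρ : Measure K)

theorem countable_atoms [IsProbabilityMeasure ρ] : {k | ρ {k} = 0}ᶜ.Countable := by
  have h := Measure.countable_meas_level_set_pos (μ := ρ) (g := id) measurable_id
  refine h.mono fun k hk => ?_
  exact pos_iff_ne_zero.2 hk

theorem measurableSet_setOf_measure_singleton_eq_zero [IsProbabilityMeasure ρ] :
    MeasurableSet {k | ρ {k} = 0} :=
  (countable_atoms ρ).measurableSet.of_compl

instance [IsProbabilityMeasure ρ] : IsProbabilityMeasure (spreadAtoms ρ) := by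
  constructor
  have h := measurableSet_setOf_measure_singleton_eq_zero ρ
  rw [spreadAtoms, Measure.add_apply, ← Set.univ_prod_univ, Measure.prod_prod, Measure.prod_prod]
  simp only [measure_univ, mul_one, Measure.restrict_apply_univ]
  rw [measure_add_measure_compl h, measure_univ]

/-- Off the atoms of `ρ` the first coordinate has no point masses; over an atom the second is
uniform. Hence the spread space is isomorphic to the unit interval. -/
theorem spreadAtoms_singleton (z : K × unitInterval) : spreadAtoms ρ {z} = 0 := by
  rcases z with ⟨k, s⟩
  rw [spreadAtoms, Measure.add_apply, ← Set.singleton_prod_singleton, Measure.prod_prod,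
    Measure.prod_prod, measure_singleton (μ := (volume : Measure unitInterval)), mul_zero, add_zero,
    Measure.restrict_apply (measurableSet_singleton k)]
  by_cases hk : ρ {k} = 0
  · rw [measure_mono_null Set.inter_subset_left hk, zero_mul]
  · have : ({k} ∩ {k | ρ {k} = 0} : Set K) = ∅ := by
      ext j
      simp only [Set.mem_inter_iff, Set.mem_singleton_iff, Set.mem_ofPred_eq, Set.mem_empty_iff_false,
        iff_false, not_and]
      rintro rfl
      exact hk
    rw [this, measure_empty, zero_mul]

open scoped Classical in
/-- A measure preserving map from an atomless space lifts to the space with spread atoms. -/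
theorem exists_lift_spreadAtoms [IsProbabilityMeasure ρ] {α : Type*} [MeasurableSpace α] [StandardBorelSpace α]
    {ν : Measure α} [IsProbabilityMeasure ν] (hν : ∀ x, ν {x} = 0) {f : α → K}
    (hf : MeasurePreserving f ν ρ) :
    ∃ θ : α → unitInterval, MeasurePreserving (fun x => (f x, θ x)) ν (spreadAtoms ρ) := by
  have hfk : ∀ k, ν (f ⁻¹' {k}) = ρ {k} := fun k =>
    hf.measure_preimage (measurableSet_singleton k).nullMeasurableSet
  -- Over an atom `k`, the measure `ν` conditioned on the fibre is atomless, so the fibre carries a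
  -- uniform variable; it becomes the second coordinate there.
  have hex : ∀ k, ∃ F : α → unitInterval, Measurable F ∧ ∀ s, MeasurableSet s →
      ν (f ⁻¹' {k} ∩ F ⁻¹' s) = ρ {k} * volume s := by
    intro k
    by_cases hk : ρ {k} = 0
    · refine ⟨fun _ => 0, measurable_const, fun s _ => ?_⟩
      rw [hk, zero_mul]
      exact measure_mono_null Set.inter_subset_left ((hfk k).trans hk)
    · have hm := hf.measurable (measurableSet_singleton k)
      have := ProbabilityTheory.cond_isProbabilityMeasure (μ := ν) (s := f ⁻¹' {k})
        (by rwa [hfk])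
      obtain ⟨F, -, hF, -⟩ := exists_measurePreserving_unitInterval
        (ProbabilityTheory.cond ν (f ⁻¹' {k})) fun x => by
          rw [ProbabilityTheory.cond_apply hm, measure_mono_null Set.inter_subset_right (hν x),
            mul_zero]
      refine ⟨F, hF.measurable, fun s hs => ?_⟩
      rw [← hF.measure_preimage hs.nullMeasurableSet, ← hfk,
        mul_comm, ProbabilityTheory.cond_mul_eq_inter hm]
  choose F hFm hF using hex
  have hC := measurableSet_setOf_measure_singleton_eq_zero ρ
  have hcount := countable_atoms ρ
  let θ : α → unitInterval := fun x => if ρ {f x} = 0 then 0 else F (f x) x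
  -- The definition of `θ` varies with `f x`, but only over countably many atoms, so measurability
  -- and measures of rectangles reduce to a countable disjoint union.
  have hpre : ∀ (A : Set K) (B : Set unitInterval), f ⁻¹' A ∩ θ ⁻¹' B =
      (f ⁻¹' (A ∩ {k | ρ {k} = 0}) ∩ {_x | (0 : unitInterval) ∈ B}) ∪
        ⋃ k ∈ A ∩ {k | ρ {k} = 0}ᶜ, f ⁻¹' {k} ∩ F k ⁻¹' B := by
    intro A B
    ext x
    by_cases hx : ρ {f x} = 0
    · simp only [θ, Set.mem_inter_iff, Set.mem_preimage, hx, if_true, Set.mem_union, Set.mem_iUnion]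
      constructor
      · rintro ⟨h1, h2⟩
        exact Or.inl ⟨⟨h1, hx⟩, h2⟩
      · rintro (⟨⟨h1, -⟩, h2⟩ | ⟨k, ⟨-, h1⟩, h2, -⟩)
        · exact ⟨h1, h2⟩
        · exact absurd ((Set.mem_singleton_iff.1 h2) ▸ hx) h1
    · simp only [θ, Set.mem_inter_iff, Set.mem_preimage, hx, if_false, Set.mem_union,
        Set.mem_iUnion]
      constructor
      · rintro ⟨h1, h2⟩
        exact Or.inr ⟨f x, ⟨h1, hx⟩, rfl, h2⟩
      · rintro (⟨⟨-, h1⟩, -⟩ | ⟨k, ⟨h1, -⟩, h2, h3⟩)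
        · exact absurd h1 hx
        · obtain rfl := Set.mem_singleton_iff.1 h2
          exact ⟨h1, h3⟩
  have hmk : ∀ k B, MeasurableSet B → MeasurableSet (f ⁻¹' {k} ∩ F k ⁻¹' B) := fun k B hB =>
    (hf.measurable (measurableSet_singleton k)).inter (hFm k hB)
  have hθ : Measurable θ := fun B hB => by
    have := hpre Set.univ B
    rw [Set.preimage_univ, Set.univ_inter] at this
    rw [this]
    refine ((hf.measurable (MeasurableSet.univ.inter hC)).inter (MeasurableSet.const _)).union
      (MeasurableSet.biUnion (hcount.mono Set.inter_subset_right) fun k _ => hmk k B hB)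
  have hfθ : Measurable fun x => (f x, θ x) := hf.measurable.prodMk hθ
  refine ⟨θ, hfθ, ?_⟩
  have := Measure.isProbabilityMeasure_map (μ := ν) hfθ.aemeasurable
  refine Measure.ext_prod fun {A B} hA hB => ?_
  rw [Measure.map_apply hfθ (hA.prod hB)]
  have h1 : (fun x => (f x, θ x)) ⁻¹' (A ×ˢ B) = f ⁻¹' A ∩ θ ⁻¹' B := rfl
  have hA' : (A ∩ {k | ρ {k} = 0}ᶜ).Countable := hcount.mono Set.inter_subset_right
  rw [h1, hpre, measure_union _ (MeasurableSet.biUnion hA' fun k _ => hmk k B hB),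
    measure_biUnion hA' _ (fun k _ => hmk k B hB)]
  · simp only [hF _ B hB]
    rw [ENNReal.tsum_mul_right, spreadAtoms, Measure.add_apply, Measure.prod_prod,
      Measure.prod_prod, Measure.restrict_apply hA, Measure.restrict_apply hA,
      Measure.dirac_apply' _ hB]
    congr 1
    · by_cases h0 : (0 : unitInterval) ∈ B
      · have h2 : {_x : α | (0 : unitInterval) ∈ B} = Set.univ := Set.eq_univ_of_forall fun _ => h0
        rw [h2, Set.inter_univ, hf.measure_preimage (hA.inter hC).nullMeasurableSet]
        simp [h0]
      · simp [h0]
    · rw [← measure_biUnion hA' (f := fun k => {k}) _ fun k _ => measurableSet_singleton k,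
        Set.biUnion_of_singleton]
      intro i _ j _ hij
      exact Set.disjoint_singleton.2 hij
  · intro i _ j _ hij
    refine Set.disjoint_left.2 fun x hx hx' => hij ?_
    exact (Set.mem_singleton_iff.1 hx.1).symm.trans (Set.mem_singleton_iff.1 hx'.1)
  · refine Set.disjoint_left.2 fun x hx hx' => ?_
    obtain ⟨k, hk, hx2⟩ := Set.mem_iUnion₂.1 hx'
    have := Set.mem_singleton_iff.1 hx2.1
    exact hk.2 (this ▸ hx.1.2)

end UnitInterval

namespace Graphon

/-- Weak isomorphisms of graphons on the unit interval into a common graphon can be replaced by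
weak isomorphisms into a graphon on the unit interval. -/
theorem exists_unitInterval {H H' : Graphon unitInterval volume} {ρ : Measure (ℕ → ℝ)}
    [IsProbabilityMeasure ρ] {G : Graphon (ℕ → ℝ) ρ}
    (hG : Measurable fun z : (ℕ → ℝ) × (ℕ → ℝ) => G.W z.1 z.2) {f f' : unitInterval → ℕ → ℝ}
    (h : H.IsWeakIso G f) (h' : H'.IsWeakIso G f') (hu : G.UnitValued) :
    ∃ (U : Graphon unitInterval volume) (φ ψ : unitInterval → unitInterval),
      U.UnitValued ∧ H.IsWeakIso U φ ∧ H'.IsWeakIso U ψ := by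
  obtain ⟨F, Q, hF, hQ, hQF⟩ := exists_measurePreserving_unitInterval (spreadAtoms ρ)
    (spreadAtoms_singleton ρ)
  have hUm : Measurable fun z : unitInterval × unitInterval => G.W (Q z.1).1 (Q z.2).1 :=
    hG.comp (((measurable_fst.comp hQ).comp measurable_fst).prodMk
      ((measurable_fst.comp hQ).comp measurable_snd))
  let U : Graphon unitInterval volume :=
    ⟨fun x y => G.W (Q x).1 (Q y).1, fun x y => G.symm _ _,
      G.bounded.imp fun C hC x y => hC _ _, hUm.nullMeasurable⟩
  have key : ∀ {H : Graphon unitInterval volume} {f : unitInterval → ℕ → ℝ},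
      H.IsWeakIso G f → ∃ φ, H.IsWeakIso U φ := by
    intro H f h
    rw [isWeakIso_iff] at h
    obtain ⟨g, hg, hfg⟩ := h.1.exists_measurePreserving
    obtain ⟨θ, hθ⟩ := exists_lift_spreadAtoms ρ
      (fun x => measure_singleton (μ := (volume : Measure unitInterval)) x) hg
    -- `Q` undoes `F` almost everywhere, and the first projection then forgets the spread, so `U` at
    -- the new points is `G` at the old ones.
    refine ⟨fun x => F (g x, θ x), isWeakIso_iff.2 ⟨(hF.comp hθ).nullMeasurePreserving, ?_⟩⟩
    have h1 : ∀ᵐ x ∂(volume : Measure unitInterval), (Q (F (g x, θ x))).1 = f x := by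
      filter_upwards [hθ.quasiMeasurePreserving.ae hQF, hfg] with x h2 h3
      rw [h2, h3]
    filter_upwards [h.2, Measure.quasiMeasurePreserving_fst.ae h1,
      Measure.quasiMeasurePreserving_snd.ae h1] with z h2 h3 h4
    simp only [U]
    rw [h2, h3, h4]
  obtain ⟨φ, hφ⟩ := key h
  obtain ⟨ψ, hψ⟩ := key h'
  exact ⟨U, φ, ψ, fun x y => hu _ _, hφ, hψ⟩

end Graphon

/-! ### The theorem -/

theorem theorem1 :
    -- (i) almost twin-free graphons on Lebesgue spaces
    (∀ (Ω : Type u) (Ω' : Type v) [MeasurableSpace Ω] [MeasurableSpace Ω']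
      (π : Measure Ω) [IsProbabilityMeasure π] (π' : Measure Ω') [IsProbabilityMeasure π']
      (H : Graphon Ω π) (H' : Graphon Ω' π'),
      IsLebesgueSpace π → IsLebesgueSpace π' → H.AlmostTwinFree → H'.AlmostTwinFree →
      ((∀ (k : ℕ) (F : SimpleGraph (Fin k)), H.density F = H'.density F) ↔
        H.IsomorphicModZero H')) ∧
    -- (ii) arbitrary graphons
    (∀ (Ω : Type u) (Ω' : Type v) [MeasurableSpace Ω] [MeasurableSpace Ω']
      (π : Measure Ω) [IsProbabilityMeasure π] (π' : Measure Ω') [IsProbabilityMeasure π']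
      (H : Graphon Ω π) (H' : Graphon Ω' π'),
      (∀ (k : ℕ) (F : SimpleGraph (Fin k)), H.density F = H'.density F) ↔
        Graphon.WeaklyIsomorphic.{u, v, w} H H') ∧
    -- uniqueness of the limit of a convergent graph sequence up to measure-preserving maps
    (∀ (m : ℕ → ℕ) (G : ∀ n, SimpleGraph (Fin (m n))), (∀ n, 0 < m n) →
      ∀ H H' : Graphon unitInterval volume, H.UnitValued → H'.UnitValued → H.IsLimitOf G →
      (H'.IsLimitOf G ↔
        ∃ (U : Graphon unitInterval volume) (φ ψ : unitInterval → unitInterval),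
          U.UnitValued ∧ H.IsWeakIso U φ ∧ H'.IsWeakIso U ψ)) := by
  refine ⟨?_, ?_, ?_⟩
  · intro Ω Ω' _ _ π _ π' _ H H' hπ hπ' hH hH'
    exact ⟨Graphon.isomorphicModZero_of_density_eq hπ hπ' hH hH', fun h => h.density_eq⟩
  · intro Ω Ω' _ _ π _ π' _ H H'
    exact ⟨Graphon.weaklyIsomorphic_of_density_eq, Graphon.density_eq_of_weaklyIsomorphic⟩
  · intro m G _ H H' hH _ hlim
    constructor
    · intro hlim'
      obtain ⟨ρ, _, G₀, f, f', hG₀, hu, h1, h2⟩ := Graphon.exists_isWeakIso_of_density_eq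
        (fun k F => tendsto_nhds_unique (hlim k F) (hlim' k F)) zero_le_one hH
      exact Graphon.exists_unitInterval hG₀ h1 h2 hu
    · rintro ⟨U, φ, ψ, -, h1, h2⟩ k F
      rw [h2.density_eq, ← h1.density_eq]
      exact hlim k F
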